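/- Let $M$ be a connected smooth manifold of dimension $n$, with induced coordinates $(x^i,y^i)$ on $TM$, let $T_0M$ be $TM$ with the zero section removed, let $\mathcal C=y^i\,\partial/\partial y^i$ be the Liouville vector field and $J=dx^i\otimes\partial/\partial y^i$ the tangent endomorphism. A function $f\in C^\infty(T_0M)$ is called $p$-homogeneous if $\mathcal C(f)=pf$. For a vector field $G$ on $T_0M$ and a smooth function $L$ on $T_0M$ put $d_JL=dL\circ J$ and $\delta_GL=\mathcal L_G d_JL-dL$; when $JG=\mathcal C$, this reads $\delta_GL=\{G(\partial L/\partial y^i)-\partial L/\partial x^i\}\,dx^i$. A Finsler metric is a continuous function $F:TM\to[0,\infty)$ which is smooth and positive on $T_0M$, satisfies $F(x,\lambda y)=\lambda F(x,y)$ for all $\lambda>0$, and whose metric tensor $g_{ij}=\frac12\,\partial^2F^2/\partial y^i\partial y^j$ has rank $n$ on $T_0M$. Its geodesic spray is the vector field $G$ on $T_0M$ determined by $i_G\,dd_JL=-dL$, where $L=\frac12F^2$. Fix a volume form $\omega=\sigma(x)\,dx\wedge dy$ on $T_0M$ with $\sigma>0$ smooth. The distortion, the $S$-function and the $\chi$-curvature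 of $F$ are $$\tau=\tfrac12\ln\frac{\det g}{\sigma},\qquad S=G(\tau),\qquad \chi=\tfrac12\,\delta_GS .$$ A Hamel function for $G$ is a $1$-homogeneous $f\in C^\infty(T_0M)$ with $\delta_Gf=0$; it is a strong Hamel function for $G$ if moreover $f=G(f_0)$ for some $0$-homogeneous $f_0\in C^\infty(T_0M)$. Theorem. Let $F$ and $\widetilde F$ be Finsler metrics on $M$ whose geodesic sprays $G$ and $\widetilde G$ are projectively related, that is, $\widetilde G=G-2P\mathcal C$ on $T_0M$ for some $1$-homogeneous function $P\in C^\infty(T_0M)$. Let $S,\chi$ and $\widetilde S,\widetilde\chi$ be their $S$-functions and $\chi$-curvatures with respect to the same volume form $\omega$. Then, on $T_0M$, $$\widetilde S=S+(n+1)P,\qquad \widetilde\chi=\chi+\frac{n+1}{2}\,\delta_GP .$$ Moreover, $\widetilde\chi=\chi$ on $T_0M$ if and only if $P$ is a strong Hamel function for $G$. -/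

import Mathlib

open scoped Manifold ContDiff

noncomputable section

namespace FinslerSpray

/-- The coordinate space `ℝⁿ`. -/
abbrev Coord (n : ℕ) := EuclideanSpace ℝ (Fin n)

section Basic

variable {n : ℕ} {M : Type*} [TopologicalSpace M] [ChartedSpace (Coord n) M]
  [IsManifold (𝓡 n) ∞ M]

/-! ### The slit tangent bundle, natural charts, and the canonical structures on `TM` -/

/-- The slit tangent bundle `T₀M`: the tangent bundle with the zero section removed.
Functions, vector fields and forms on `T₀M` are represented by functions on `TM`, whose values
on the zero section are ignored. -/
def slit (n : ℕ) (M : Type*) [TopologicalSpace M] [ChartedSpace (Coord n) M]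
    [IsManifold (𝓡 n) ∞ M] : Set (TangentBundle (𝓡 n) M) :=
  {v | v.2 ≠ 0}

/-- The induced coordinates `(xⁱ, yⁱ)` on `TM` coming from the chart of `M` around `x₀`. -/
def natChart (x₀ : M) : PartialEquiv (TangentBundle (𝓡 n) M) (Coord n × Coord n) :=
  extChartAt (𝓡 n).tangent (⟨x₀, 0⟩ : TangentBundle (𝓡 n) M)

/-- The coordinate frame of `TM` at `v` in the natural chart around `x₀`: it sends `(eᵢ, 0)` to
`∂/∂xⁱ` and `(0, eᵢ)` to `∂/∂yⁱ`. -/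
def coordFrame (x₀ : M) (v : TangentBundle (𝓡 n) M) :
    (Coord n × Coord n) →L[ℝ] TangentSpace (𝓡 n).tangent v :=
  mfderiv 𝓘(ℝ, Coord n × Coord n) (𝓡 n).tangent (natChart x₀).symm (natChart x₀ v)

/-- The `i`-th coordinate vector of `ℝⁿ`. -/
def stdVec (i : Fin n) : Coord n := EuclideanSpace.single i 1

/-- Smooth functions on `T₀M`. -/
def SmoothFun (f : TangentBundle (𝓡 n) M → ℝ) : Prop :=
  ContMDiffOn (𝓡 n).tangent 𝓘(ℝ, ℝ) ∞ f (slit n M)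

/-- Smooth vector fields on `T₀M`. -/
def SmoothField (X : ∀ v : TangentBundle (𝓡 n) M, TangentSpace (𝓡 n).tangent v) : Prop :=
  ContMDiffOn (𝓡 n).tangent (𝓡 n).tangent.tangent ∞
    (fun v => (⟨v, X v⟩ : TangentBundle (𝓡 n).tangent (TangentBundle (𝓡 n) M))) (slit n M)

/-- The differential `df` of a function on `TM`. -/
def diff (f : TangentBundle (𝓡 n) M → ℝ) (v : TangentBundle (𝓡 n) M) :
    TangentSpace (𝓡 n).tangent v →L[ℝ] ℝ :=
  mfderiv (𝓡 n).tangent 𝓘(ℝ, ℝ) f v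

/-- The derivative `X(f)` of a function along a vector field. -/
def act (X : ∀ v : TangentBundle (𝓡 n) M, TangentSpace (𝓡 n).tangent v)
    (f : TangentBundle (𝓡 n) M → ℝ) (v : TangentBundle (𝓡 n) M) : ℝ :=
  diff f v (X v)

/-- The vertical lift `T_xM → T_v(TM)`, `x = π(v)`: the differential at `v` of the inclusion of
the fibre `T_xM` into `TM`. -/
def verticalLift (v : TangentBundle (𝓡 n) M) :
    TangentSpace (𝓡 n) v.proj →L[ℝ] TangentSpace (𝓡 n).tangent v :=
  mfderiv 𝓘(ℝ, Coord n) (𝓡 n).tangent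
    (fun w : Coord n => (⟨v.proj, w⟩ : TangentBundle (𝓡 n) M)) v.2

/-- The Liouville vector field `𝒞 = yⁱ ∂/∂yⁱ`. -/
def liouville (v : TangentBundle (𝓡 n) M) : TangentSpace (𝓡 n).tangent v :=
  verticalLift v v.2

/-- The tangent endomorphism `J = dxⁱ ⊗ ∂/∂yⁱ`. -/
def tangentEndo (v : TangentBundle (𝓡 n) M) :
    TangentSpace (𝓡 n).tangent v →L[ℝ] TangentSpace (𝓡 n).tangent v :=
  (verticalLift v).comp
    (mfderiv (𝓡 n).tangent (𝓡 n) (fun w : TangentBundle (𝓡 n) M => w.proj) v)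

/-- `f` is homogeneous of degree `p` on `T₀M`: `𝒞(f) = p f`. -/
def Homogeneous (p : ℝ) (f : TangentBundle (𝓡 n) M → ℝ) : Prop :=
  ∀ v ∈ slit n M, act liouville f v = p * f v

/-! ### Calculus of 1-forms on `TM` -/

/-- A 1-form on `TM` read in the natural chart around `x₀`. -/
def localForm (α : ∀ v : TangentBundle (𝓡 n) M, TangentSpace (𝓡 n).tangent v →L[ℝ] ℝ) (x₀ : M)
    (z : Coord n × Coord n) : (Coord n × Coord n) →L[ℝ] ℝ :=
  (α ((natChart x₀).symm z)).comp
    (mfderiv 𝓘(ℝ, Coord n × Coord n) (𝓡 n).tangent (natChart x₀).symm z)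

/-- The contraction `i_ξ dα` at `v` of the exterior derivative of a 1-form, computed in the natural
chart around `π(v)`: `dα(ξ, η) = (D_ξ α)(η) - (D_η α)(ξ)`. -/
def contractExtDeriv
    (α : ∀ v : TangentBundle (𝓡 n) M, TangentSpace (𝓡 n).tangent v →L[ℝ] ℝ)
    (v : TangentBundle (𝓡 n) M) (ξ : TangentSpace (𝓡 n).tangent v) :
    TangentSpace (𝓡 n).tangent v →L[ℝ] ℝ :=
  let A : TangentSpace (𝓡 n).tangent v →L[ℝ] (Coord n × Coord n) :=
    mfderiv (𝓡 n).tangent 𝓘(ℝ, Coord n × Coord n) (natChart v.proj) v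
  let D : (Coord n × Coord n) →L[ℝ] (Coord n × Coord n) →L[ℝ] ℝ :=
    fderiv ℝ (localForm α v.proj) (natChart v.proj v)
  (D (A ξ) - D.flip (A ξ)).comp A

/-- The Lie derivative `ℒ_X α = i_X dα + d(α(X))` of a 1-form. -/
def lieDerivForm (X : ∀ v : TangentBundle (𝓡 n) M, TangentSpace (𝓡 n).tangent v)
    (α : ∀ v : TangentBundle (𝓡 n) M, TangentSpace (𝓡 n).tangent v →L[ℝ] ℝ)
    (v : TangentBundle (𝓡 n) M) : TangentSpace (𝓡 n).tangent v →L[ℝ] ℝ :=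
  contractExtDeriv α v (X v) + diff (fun w => α w (X w)) v

/-- The 1-form `d_J L = dL ∘ J`. -/
def vertDiff (L : TangentBundle (𝓡 n) M → ℝ) (v : TangentBundle (𝓡 n) M) :
    TangentSpace (𝓡 n).tangent v →L[ℝ] ℝ :=
  (diff L v).comp (tangentEndo v)

/-- The Euler-Lagrange 1-form `δ_G L = ℒ_G d_J L - dL`. -/
def eulerLagrange (G : ∀ v : TangentBundle (𝓡 n) M, TangentSpace (𝓡 n).tangent v)
    (L : TangentBundle (𝓡 n) M → ℝ) (v : TangentBundle (𝓡 n) M) :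
    TangentSpace (𝓡 n).tangent v →L[ℝ] ℝ :=
  lieDerivForm G (vertDiff L) v - diff L v

/-! ### Finsler metrics and geodesic sprays -/

/-- The components `gᵢⱼ = ½ ∂²F²/∂yⁱ∂yʲ` at `v` in the natural chart around `x₀`. -/
def metricMatrix (F : TangentBundle (𝓡 n) M → ℝ) (x₀ : M) (v : TangentBundle (𝓡 n) M) :
    Matrix (Fin n) (Fin n) ℝ :=
  fun i j => (1 / 2 : ℝ) *
    fderiv ℝ (fun z => fderiv ℝ (fun z' => F ((natChart x₀).symm z') ^ 2) z (0, stdVec j))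
      (natChart x₀ v) (0, stdVec i)

/-- Finsler metrics on `M`. -/
structure IsFinsler (F : TangentBundle (𝓡 n) M → ℝ) : Prop where
  continuous : Continuous F
  nonneg : ∀ v, 0 ≤ F v
  smooth : SmoothFun F
  pos : ∀ v ∈ slit n M, 0 < F v
  homogeneous : ∀ (x : M) (y : TangentSpace (𝓡 n) x) (c : ℝ), 0 < c →
    F ⟨x, c • y⟩ = c * F ⟨x, y⟩
  rank_eq : ∀ (x₀ : M), ∀ v ∈ slit n M, v.proj ∈ (chartAt (Coord n) x₀).source →
    (metricMatrix F x₀ v).rank = n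

/-- `G` is the geodesic spray of `F`: the vector field on `T₀M` determined by
`i_G d d_J L = -dL`, where `L = ½ F²`. -/
structure IsGeodesicSpray (F : TangentBundle (𝓡 n) M → ℝ)
    (G : ∀ v : TangentBundle (𝓡 n) M, TangentSpace (𝓡 n).tangent v) : Prop where
  smooth : SmoothField G
  eq : ∀ v ∈ slit n M,
    contractExtDeriv (vertDiff (fun w => (1 / 2 : ℝ) * F w ^ 2)) v (G v)
      = -diff (fun w => (1 / 2 : ℝ) * F w ^ 2) v

/-- `G'` is the projective deformation `G - 2P𝒞` of `G` on `T₀M`, where the projective factor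
`P` is a smooth 1-homogeneous function on `T₀M`. -/
structure IsProjectiveDeformation
    (G G' : ∀ v : TangentBundle (𝓡 n) M, TangentSpace (𝓡 n).tangent v)
    (P : TangentBundle (𝓡 n) M → ℝ) : Prop where
  smooth : SmoothFun P
  homogeneous : Homogeneous 1 P
  eq : ∀ v ∈ slit n M, G' v = G v - (2 * P v) • liouville v

/-- Hamel functions: smooth 1-homogeneous functions on `T₀M` with `δ_G f = 0`. -/
structure IsHamel (G : ∀ v : TangentBundle (𝓡 n) M, TangentSpace (𝓡 n).tangent v)
    (f : TangentBundle (𝓡 n) M → ℝ) : Prop where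
  smooth : SmoothFun f
  homogeneous : Homogeneous 1 f
  eulerLagrange_eq : ∀ v ∈ slit n M, eulerLagrange G f v = 0

/-- Strong Hamel functions: Hamel functions of the form `f = G(f₀)` with `f₀` smooth and
0-homogeneous on `T₀M`. -/
structure IsStrongHamel (G : ∀ v : TangentBundle (𝓡 n) M, TangentSpace (𝓡 n).tangent v)
    (f : TangentBundle (𝓡 n) M → ℝ) : Prop where
  hamel : IsHamel G f
  exists_primitive : ∃ f₀ : TangentBundle (𝓡 n) M → ℝ,
    SmoothFun f₀ ∧ Homogeneous 0 f₀ ∧ ∀ v ∈ slit n M, f v = act G f₀ v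

/-! ### Volume forms, the distortion, the `S`-function and the `χ`-curvature -/

/-- The coefficient of `dx¹ ∧ ⋯ ∧ dxⁿ ∧ dy¹ ∧ ⋯ ∧ dyⁿ` in a `2n`-form on `TM` at `v`, in the natural
chart around `x₀`. -/
def volCoeff
    (Ω : ∀ v : TangentBundle (𝓡 n) M, (TangentSpace (𝓡 n).tangent v) [⋀^Fin n ⊕ Fin n]→ₗ[ℝ] ℝ)
    (x₀ : M) (v : TangentBundle (𝓡 n) M) : ℝ :=
  Ω v (Sum.elim (fun i => coordFrame x₀ v (stdVec i, 0)) (fun i => coordFrame x₀ v (0, stdVec i)))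

/-- `Ω` is a smooth volume form on `T₀M` which in every natural chart reads `σ(x) dx ∧ dy`, with
`σ > 0` depending on the base point only. (The orientation of `T₀M` given by `dx ∧ dy` does not
depend on the natural chart.) -/
def IsVolumeForm
    (Ω : ∀ v : TangentBundle (𝓡 n) M, (TangentSpace (𝓡 n).tangent v) [⋀^Fin n ⊕ Fin n]→ₗ[ℝ] ℝ) :
    Prop :=
  ∀ x₀ : M, ∃ σ : Coord n → ℝ,
    ContDiffOn ℝ ∞ σ (chartAt (Coord n) x₀).target ∧
    (∀ x ∈ (chartAt (Coord n) x₀).target, 0 < σ x) ∧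
    ∀ v ∈ slit n M, v.proj ∈ (chartAt (Coord n) x₀).source →
      volCoeff Ω x₀ v = σ (chartAt (Coord n) x₀ v.proj)

/-- The distortion `τ = ½ ln (det g / σ)`. Both `det g` and `σ` are taken in the natural chart
around `π(v)`; their quotient does not depend on the natural chart. -/
def distortion (F : TangentBundle (𝓡 n) M → ℝ)
    (Ω : ∀ v : TangentBundle (𝓡 n) M, (TangentSpace (𝓡 n).tangent v) [⋀^Fin n ⊕ Fin n]→ₗ[ℝ] ℝ)
    (v : TangentBundle (𝓡 n) M) : ℝ :=
  (1 / 2 : ℝ) * Real.log ((metricMatrix F v.proj v).det / volCoeff Ω v.proj v)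

/-- The `S`-function `S = G(τ)`. -/
def sFunction (F : TangentBundle (𝓡 n) M → ℝ)
    (G : ∀ v : TangentBundle (𝓡 n) M, TangentSpace (𝓡 n).tangent v)
    (Ω : ∀ v : TangentBundle (𝓡 n) M, (TangentSpace (𝓡 n).tangent v) [⋀^Fin n ⊕ Fin n]→ₗ[ℝ] ℝ) :
    TangentBundle (𝓡 n) M → ℝ :=
  act G (distortion F Ω)

/-- The `χ`-curvature `χ = ½ δ_G S`. -/
def chiCurvature (F : TangentBundle (𝓡 n) M → ℝ)
    (G : ∀ v : TangentBundle (𝓡 n) M, TangentSpace (𝓡 n).tangent v)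
    (Ω : ∀ v : TangentBundle (𝓡 n) M, (TangentSpace (𝓡 n).tangent v) [⋀^Fin n ⊕ Fin n]→ₗ[ℝ] ℝ)
    (v : TangentBundle (𝓡 n) M) : TangentSpace (𝓡 n).tangent v →L[ℝ] ℝ :=
  (1 / 2 : ℝ) • eulerLagrange G (sFunction F G Ω) v

end Basic

end FinslerSpray

end

open scoped Manifold ContDiff

noncomputable section

namespace FinslerSpray

/-! Write `G = yⁱ ∂/∂xⁱ + Gⁱ ∂/∂yⁱ` and `L = ½F²`. The geodesic equation is `G(∂L/∂yᶜ) = ∂L/∂xᶜ`.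
Its derivative along `yᵉ` expresses `G(g)` as `-(∂Gⁱ/∂yᵉ) gᵢ_c` plus a term antisymmetric in `e, c`.
Tracing against the symmetric `g⁻¹` removes that term, so `G(ln |det g|) = -∂Gⁱ/∂yⁱ`
(`fderiv_log_det_field`). Hence `S = -½(∂Gⁱ/∂yⁱ + yⁱ ∂ᵢ ln σ)`, where the metric enters only through
its spray (`sFunction_eq`). Replacing `Gⁱ` by `Gⁱ - 2Pyⁱ` changes the divergence by `-2(nP + yⁱ
∂P/∂yⁱ) = -2(n+1)P`, which is the formula for `S`.

For `χ`, the form `δ_G f` of a 1-homogeneous `f` is the same for both sprays, because `∂f/∂yⁱ` is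
0-homogeneous and so is killed by `𝒞` (`IsProjectiveDeformation.eulerLagrange_eq`). Apply this to
`S̃` and use linearity. Thus `χ̃ = χ` is equivalent to `δ_G P = 0`. The primitive of `P` always
exists: the distortions are 0-homogeneous, so `G̃(τ̃) = G(τ̃)` and `(n+1)P = G(τ̃ - τ)`.

On the manifold, the exterior derivative and the distortion are defined in the chart at the moving
point `π(v)`. They become computable in a fixed chart through `contractExtDeriv_eq` and
`IsFinsler.distortion_eq`. -/

/-- An antisymmetric matrix is trace-orthogonal to a symmetric one. -/
lemma trace_mul_eq_zero_of_transpose_eq_neg {m : Type*} [Fintype m]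
    {A B : Matrix m m ℝ} (hA : A.transpose = A) (hB : B.transpose = -B) : (A * B).trace = 0 := by
  have h : (A * B).trace = -(A * B).trace := by
    conv_lhs => rw [← Matrix.trace_transpose, Matrix.transpose_mul, hA, hB, Matrix.trace_mul_comm,
      Matrix.mul_neg, Matrix.trace_neg]
  linarith

/-! ### Derivatives of determinants. -/

section Determinant

variable {V : Type*} [NormedAddCommGroup V] [NormedSpace ℝ V] {m : Type*} [Fintype m]
  [DecidableEq m]

/-- Jacobi's formula for the derivative of a determinant. -/
lemma hasFDerivAt_det {A : V → Matrix m m ℝ} {A' : m → m → V →L[ℝ] ℝ} {z : V}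
    (hA : ∀ i j, HasFDerivAt (fun w => A w i j) (A' i j) z) :
    HasFDerivAt (fun w => (A w).det)
      (∑ i, ∑ j, (A z).adjugate i j • A' j i) z := by
  have h1 : HasFDerivAt (fun w => ∑ σ : Equiv.Perm m, (Equiv.Perm.sign σ : ℝ) * ∏ i, A w (σ i) i)
      (∑ σ : Equiv.Perm m, (Equiv.Perm.sign σ : ℝ) •
        ∑ i, (∏ j ∈ Finset.univ.erase i, A z (σ j) j) • A' (σ i) i) z := by
    refine HasFDerivAt.fun_sum fun σ _ => ?_
    exact (HasFDerivAt.finsetProd fun i _ => hA (σ i) i).const_mul _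
  simp only [Matrix.det_apply']
  refine h1.congr_fderiv ?_
  ext u
  simp only [sum_apply, smul_apply, smul_eq_mul]
  -- By Cramer's rule, contracting row `i` of the adjugate with a column gives the determinant with
  -- column `i` replaced; summed over `i`, this is the product rule in the Leibniz expansion.
  have key : ∀ i, ∑ j, (A z).adjugate i j * A' j i u
      = ((A z).updateCol i fun j => A' j i u).det := by
    intro i
    rw [← Matrix.cramer_apply, Matrix.cramer_eq_adjugate_mulVec]
    rfl
  simp only [key, Matrix.det_apply', Finset.mul_sum]
  rw [Finset.sum_comm]
  refine Finset.sum_congr rfl fun i _ => Finset.sum_congr rfl fun σ _ => ?_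
  rw [← Finset.mul_prod_erase Finset.univ _ (Finset.mem_univ i), Matrix.updateCol_self]
  rw [mul_comm (A' _ _ _)]
  congr 2
  refine Finset.prod_congr rfl fun j hj => ?_
  rw [Matrix.updateCol_ne (Finset.ne_of_mem_erase hj)]

/-- `Real.log` is `ln |·|`, so a nonzero determinant of either sign is enough; the metric tensor may
be indefinite. -/
lemma fderiv_log_det {A : V → Matrix m m ℝ} {z : V}
    (hA : ∀ i j, DifferentiableAt ℝ (fun w => A w i j) z) (h0 : (A z).det ≠ 0) (u : V) :
    fderiv ℝ (fun w => Real.log (A w).det) z u =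
      ((A z)⁻¹ * Matrix.of fun i j => fderiv ℝ (fun w => A w i j) z u).trace := by
  rw [((hasFDerivAt_det fun i j => (hA i j).hasFDerivAt).log h0).fderiv]
  simp only [smul_apply, sum_apply, smul_eq_mul,
    Matrix.trace, Matrix.diag, Matrix.mul_apply, Matrix.of_apply, Matrix.inv_def,
    Ring.inverse_eq_inv', Matrix.smul_apply, Finset.mul_sum, mul_assoc]

lemma contDiffOn_det {A : V → Matrix m m ℝ} {U : Set V}
    (hA : ∀ i j, ContDiffOn ℝ ∞ (fun w => A w i j) U) :
    ContDiffOn ℝ ∞ (fun w => (A w).det) U := by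
  simp only [Matrix.det_apply']
  exact ContDiffOn.sum fun σ _ => contDiffOn_const.mul (contDiffOn_prod fun i _ => hA (σ i) i)

end Determinant

/-! ### Euler's relation and its derivatives. -/

section Homogeneous

variable {E : Type*} [NormedAddCommGroup E] [NormedSpace ℝ E] {U : Set (E × E)} {f : E × E → ℝ}
  {p : ℝ} {z : E × E}

lemma contDiffOn_fderiv {V W : Type*} [NormedAddCommGroup V] [NormedSpace ℝ V]
    [NormedAddCommGroup W] [NormedSpace ℝ W] {U : Set V} {f : V → W} (hU : IsOpen U)
    (hf : ContDiffOn ℝ ∞ f U) : ContDiffOn ℝ ∞ (fderiv ℝ f) U :=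
  hf.fderiv_of_isOpen hU (by simp)

lemma differentiableAt_of_contDiffOn {V W : Type*} [NormedAddCommGroup V] [NormedSpace ℝ V]
    [NormedAddCommGroup W] [NormedSpace ℝ W] {U : Set V} {f : V → W} {z : V} (hU : IsOpen U)
    (hf : ContDiffOn ℝ ∞ f U) (hz : z ∈ U) : DifferentiableAt ℝ f z :=
  (hf.contDiffAt (hU.mem_nhds hz)).differentiableAt (by simp)

lemma fderiv_fderiv_symm {V W : Type*} [NormedAddCommGroup V] [NormedSpace ℝ V]
    [NormedAddCommGroup W] [NormedSpace ℝ W] {U : Set V} {f : V → W} {z : V} (hU : IsOpen U)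
    (hf : ContDiffOn ℝ ∞ f U) (hz : z ∈ U) (u w : V) :
    fderiv ℝ (fderiv ℝ f) z u w = fderiv ℝ (fderiv ℝ f) z w u :=
  (hf.contDiffAt (hU.mem_nhds hz)).isSymmSndFDerivAt (by simpa using ENat.LEInfty.out) u w

lemma fderiv_vert (u : E × E) : fderiv ℝ (fun w : E × E => ((0 : E), w.2)) z u = (0, u.2) := by
  have : (fun w : E × E => ((0 : E), w.2)) =
    ((0 : E × E →L[ℝ] E).prod (ContinuousLinearMap.snd ℝ E E)) := rfl
  rw [this, ContinuousLinearMap.fderiv]; rfl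

lemma differentiableAt_vert : DifferentiableAt ℝ (fun w : E × E => ((0 : E), w.2)) z := by
  fun_prop

/-- The derivative of the Euler relation. -/
lemma euler_fderiv (hU : IsOpen U) (hf : ContDiffOn ℝ ∞ f U)
    (hh : ∀ z ∈ U, fderiv ℝ f z (0, z.2) = p * f z) (hz : z ∈ U) (u : E × E) :
    fderiv ℝ (fderiv ℝ f) z u (0, z.2) + fderiv ℝ f z (0, u.2) = p * fderiv ℝ f z u := by
  have hd := differentiableAt_of_contDiffOn hU (contDiffOn_fderiv hU hf) hz
  have h1 : fderiv ℝ (fun z => fderiv ℝ f z (0, z.2)) z u = fderiv ℝ (fun z => p * f z) z u := by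
    rw [Filter.EventuallyEq.fderiv_eq]
    filter_upwards [hU.mem_nhds hz] with w hw using hh w hw
  rw [fderiv_clm_apply hd differentiableAt_vert,
    fderiv_const_mul (differentiableAt_of_contDiffOn hU hf hz)] at h1
  simp only [add_apply, ContinuousLinearMap.comp_apply,
    ContinuousLinearMap.flip_apply, fderiv_vert, smul_apply, smul_eq_mul] at h1
  linarith

lemma fderiv_clm_apply_const {V W X : Type*} [NormedAddCommGroup V] [NormedSpace ℝ V]
    [NormedAddCommGroup W] [NormedSpace ℝ W] [NormedAddCommGroup X] [NormedSpace ℝ X]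
    {A : V → W →L[ℝ] X} {z : V} (hA : DifferentiableAt ℝ A z) (w : W) (u : V) :
    fderiv ℝ (fun z => A z w) z u = fderiv ℝ A z u w := by
  rw [fderiv_clm_apply hA (differentiableAt_const _)]; simp

/-- The second derivative of the Euler relation. -/
lemma euler_fderiv_fderiv (hU : IsOpen U) (hf : ContDiffOn ℝ ∞ f U)
    (hh : ∀ z ∈ U, fderiv ℝ f z (0, z.2) = p * f z) (hz : z ∈ U) (u w : E × E) :
    fderiv ℝ (fderiv ℝ (fderiv ℝ f)) z u w (0, z.2) + fderiv ℝ (fderiv ℝ f) z w (0, u.2)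
      + fderiv ℝ (fderiv ℝ f) z u (0, w.2) = p * fderiv ℝ (fderiv ℝ f) z u w := by
  have hf1 := contDiffOn_fderiv hU hf
  have hf2 := contDiffOn_fderiv hU hf1
  have hd1 := differentiableAt_of_contDiffOn hU hf1 hz
  have hd2 := differentiableAt_of_contDiffOn hU hf2 hz
  have h1 : fderiv ℝ (fun z => fderiv ℝ (fderiv ℝ f) z w (0, z.2) + fderiv ℝ f z (0, w.2)) z u
      = fderiv ℝ (fun z => p * fderiv ℝ f z w) z u := by
    rw [Filter.EventuallyEq.fderiv_eq]
    filter_upwards [hU.mem_nhds hz] with x hx using euler_fderiv hU hf hh hx w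
  have hdw : DifferentiableAt ℝ (fun z => fderiv ℝ (fderiv ℝ f) z w) z :=
    hd2.clm_apply (differentiableAt_const _)
  have hd0 (k : E × E) : DifferentiableAt ℝ (fun z => fderiv ℝ f z k) z :=
    hd1.clm_apply (differentiableAt_const _)
  rw [fderiv_fun_add (hdw.clm_apply differentiableAt_vert) (hd0 _), fderiv_const_mul (hd0 _),
    fderiv_clm_apply hdw differentiableAt_vert] at h1
  simp only [add_apply, ContinuousLinearMap.comp_apply,
    ContinuousLinearMap.flip_apply, fderiv_vert, smul_apply, smul_eq_mul,
    fderiv_clm_apply_const hd1, fderiv_clm_apply_const hd2] at h1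
  linarith

end Homogeneous

/-! ### Geodesic sprays of a regular Lagrangian in coordinates. -/

section LocalSpray

variable {E : Type*} [NormedAddCommGroup E] [NormedSpace ℝ E] {U : Set (E × E)} {L : E × E → ℝ}
  {G : E × E → E × E} {z : E × E}

/-- The coordinate form of a regular 2-homogeneous Lagrangian together with its geodesic spray,
i.e. the solution of `i_G dd_J L = -dL`. -/
structure IsLocalSpray (U : Set (E × E)) (L : E × E → ℝ) (G : E × E → E × E) : Prop where
  isOpen : IsOpen U
  smooth_lagrangian : ContDiffOn ℝ ∞ L U
  smooth_field : ContDiffOn ℝ ∞ G U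
  euler : ∀ z ∈ U, fderiv ℝ L z (0, z.2) = 2 * L z
  nondegenerate : ∀ z ∈ U, ∀ a : E,
    (∀ d : E, fderiv ℝ (fderiv ℝ L) z (0, d) (0, a) = 0) → a = 0
  geodesic : ∀ z ∈ U, ∀ u : E × E, fderiv ℝ (fderiv ℝ L) z (G z) (0, u.1)
    - fderiv ℝ (fderiv ℝ L) z u (0, (G z).1) = -fderiv ℝ L z u

namespace IsLocalSpray

/-- A geodesic spray is a semispray: `JG = 𝒞`. -/
lemma fst_eq (h : IsLocalSpray U L G) (hz : z ∈ U) : (G z).1 = z.2 := by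
  -- On a vertical `u = (0, d)` the geodesic equation reads `g(d, (G z).1) = ∂L/∂y(d)`, and the
  -- differentiated Euler relation reads `g(d, y) = ∂L/∂y(d)`.
  refine sub_eq_zero.1 (h.nondegenerate z hz _ fun d => ?_)
  have h1 := h.geodesic z hz (0, d)
  have h2 := euler_fderiv h.isOpen h.smooth_lagrangian h.euler hz (0, d)
  have h3 : ((0 : E), (G z).1 - z.2) = (0, (G z).1) - (0, z.2) := by simp
  rw [h3, map_sub]
  have h4 : ((0 : E), (0 : E)) = 0 := rfl
  simp only [h4, map_zero] at h1
  linarith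

/-- The Euler-Lagrange equations. -/
lemma eulerLagrange_eq (h : IsLocalSpray U L G) (hz : z ∈ U) (c : E) :
    fderiv ℝ (fderiv ℝ L) z (G z) (0, c) = fderiv ℝ L z (c, 0) := by
  have h1 := h.geodesic z hz (c, 0)
  have h2 := euler_fderiv h.isOpen h.smooth_lagrangian h.euler hz (c, 0)
  have h4 : ((0 : E), (0 : E)) = 0 := rfl
  -- Since `∂L/∂x` is 2-homogeneous, the mixed term `D²L (c, 0) (0, y)` is twice `∂L/∂x(c)`, which
  -- turns the right side `-∂L/∂x(c)` into `+∂L/∂x(c)`.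
  rw [h.fst_eq hz] at h1
  simp only [h4, map_zero] at h1 h2
  linarith

lemma fderiv_fst (h : IsLocalSpray U L G) (hz : z ∈ U) (u : E × E) :
    (fderiv ℝ G z u).1 = u.2 := by
  have h1 : fderiv ℝ (fun w => (G w).1) z = fderiv ℝ (fun w : E × E => w.2) z := by
    apply Filter.EventuallyEq.fderiv_eq
    filter_upwards [h.isOpen.mem_nhds hz] with w hw using h.fst_eq hw
  rw [fderiv.fst (differentiableAt_of_contDiffOn h.isOpen h.smooth_field hz)] at h1
  rw [_root_.fderiv_snd] at h1
  exact DFunLike.congr_fun h1 u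

/-- The Euler-Lagrange equations differentiated along the fibres. -/
lemma fderiv_eulerLagrange_eq (h : IsLocalSpray U L G) (hz : z ∈ U) (u : E × E) (c : E) :
    fderiv ℝ (fderiv ℝ (fderiv ℝ L)) z u (G z) (0, c)
      + fderiv ℝ (fderiv ℝ L) z (fderiv ℝ G z u) (0, c)
      = fderiv ℝ (fderiv ℝ L) z u (c, 0) := by
  have hf1 := contDiffOn_fderiv h.isOpen h.smooth_lagrangian
  have hd1 := differentiableAt_of_contDiffOn h.isOpen hf1 hz
  have hd2 := differentiableAt_of_contDiffOn h.isOpen (contDiffOn_fderiv h.isOpen hf1) hz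
  have hG := differentiableAt_of_contDiffOn h.isOpen h.smooth_field hz
  have h1 : fderiv ℝ (fun z => fderiv ℝ (fderiv ℝ L) z (G z) (0, c)) z u
      = fderiv ℝ (fun z => fderiv ℝ L z (c, 0)) z u := by
    rw [Filter.EventuallyEq.fderiv_eq]
    filter_upwards [h.isOpen.mem_nhds hz] with x hx using h.eulerLagrange_eq hx c
  rw [fderiv_clm_apply_const (hd2.clm_apply hG), fderiv_clm_apply_const hd1,
    fderiv_clm_apply hd2 hG] at h1
  simp only [add_apply, ContinuousLinearMap.comp_apply, ContinuousLinearMap.flip_apply] at h1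
  linarith

lemma fderiv_fderiv_fderiv_symm (h : IsLocalSpray U L G) (hz : z ∈ U) (u v w : E × E) :
    fderiv ℝ (fderiv ℝ (fderiv ℝ L)) z u v w = fderiv ℝ (fderiv ℝ (fderiv ℝ L)) z v u w := by
  rw [fderiv_fderiv_symm h.isOpen (contDiffOn_fderiv h.isOpen h.smooth_lagrangian) hz]

/-- The symmetry of the Hessian holds on an open set, so it can be differentiated. With the exchange
of the first two slots, the third derivative is fully symmetric. -/
lemma fderiv_fderiv_fderiv_symm_right (h : IsLocalSpray U L G) (hz : z ∈ U) (u v w : E × E) :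
    fderiv ℝ (fderiv ℝ (fderiv ℝ L)) z u v w = fderiv ℝ (fderiv ℝ (fderiv ℝ L)) z u w v := by
  have hf1 := contDiffOn_fderiv h.isOpen h.smooth_lagrangian
  have hd2 := differentiableAt_of_contDiffOn h.isOpen (contDiffOn_fderiv h.isOpen hf1) hz
  have h1 : fderiv ℝ (fun z => fderiv ℝ (fderiv ℝ L) z v w) z u
      = fderiv ℝ (fun z => fderiv ℝ (fderiv ℝ L) z w v) z u := by
    rw [Filter.EventuallyEq.fderiv_eq]
    filter_upwards [h.isOpen.mem_nhds hz] with x hx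
      using fderiv_fderiv_symm h.isOpen h.smooth_lagrangian hx v w
  rw [fderiv_clm_apply_const (hd2.clm_apply (differentiableAt_const _)),
    fderiv_clm_apply_const (hd2.clm_apply (differentiableAt_const _)),
    fderiv_clm_apply_const hd2, fderiv_clm_apply_const hd2] at h1
  exact h1

/-- The metric tensor is 0-homogeneous. -/
lemma fderiv_metric_vert (h : IsLocalSpray U L G) (hz : z ∈ U) (c d : E) :
    fderiv ℝ (fderiv ℝ (fderiv ℝ L)) z (0, z.2) (0, c) (0, d) = 0 := by
  -- For degree 2, the two Hessian terms on the left cancel the doubled Hessian on the right.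
  have h1 := euler_fderiv_fderiv h.isOpen h.smooth_lagrangian h.euler hz (0, c) (0, d)
  have h2 := fderiv_fderiv_symm h.isOpen h.smooth_lagrangian hz (0, c) (0, d)
  rw [h.fderiv_fderiv_fderiv_symm hz, h.fderiv_fderiv_fderiv_symm_right hz]
  simp only at h1
  linarith

/-- The coefficients of a geodesic spray are 2-homogeneous. -/
lemma fderiv_vert (h : IsLocalSpray U L G) (hz : z ∈ U) :
    fderiv ℝ G z (0, z.2) = (z.2, (2 : ℝ) • (G z).2) := by
  refine Prod.ext (h.fderiv_fst hz _) (sub_eq_zero.1 (h.nondegenerate z hz _ fun c => ?_))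
  have h0 := h.fderiv_eulerLagrange_eq hz (0, z.2) c
  have h1 := euler_fderiv_fderiv h.isOpen h.smooth_lagrangian h.euler hz (G z) (0, c)
  have h2 := euler_fderiv h.isOpen h.smooth_lagrangian h.euler hz (c, 0)
  have h3 := h.eulerLagrange_eq hz c
  have h4 : ((0 : E), (0 : E)) = 0 := rfl
  -- The middle summand is the defect from 2-homogeneity. In the Euler-Lagrange equation
  -- differentiated along `(0, y)`, Euler's relations cancel all other terms, so the defect is
  -- `g`-orthogonal to every vertical vector.
  have h5 : fderiv ℝ G z (0, z.2) = G z + (0, (fderiv ℝ G z (0, z.2)).2 - (2 : ℝ) • (G z).2)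
      + (0, (G z).2) := by
    refine Prod.ext ?_ ?_
    · simp [h.fderiv_fst hz, h.fst_eq hz]
    · simp only [Prod.snd_add]; module
  rw [h5, map_add, map_add] at h0
  simp only [add_apply] at h0
  have s1 := h.fderiv_fderiv_fderiv_symm hz (0, z.2) (G z) (0, c)
  have s2 := h.fderiv_fderiv_fderiv_symm_right hz (G z) (0, z.2) (0, c)
  have s3 := fderiv_fderiv_symm h.isOpen h.smooth_lagrangian hz (0, z.2) (c, 0)
  have s4 := fderiv_fderiv_symm h.isOpen h.smooth_lagrangian hz (0, c) (0, (G z).2)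
  have s5 := fderiv_fderiv_symm h.isOpen h.smooth_lagrangian hz (0, c)
    (0, (fderiv ℝ G z (0, z.2)).2 - (2 : ℝ) • (G z).2)
  simp only [h4, map_zero] at h2
  linarith

/-- The derivative of the metric tensor along its geodesic spray. -/
lemma fderiv_metric_field (h : IsLocalSpray U L G) (hz : z ∈ U) (e c : E) :
    fderiv ℝ (fderiv ℝ (fderiv ℝ L)) z (G z) (0, e) (0, c) =
      -fderiv ℝ (fderiv ℝ L) z (0, (fderiv ℝ G z (0, e)).2) (0, c)
      + (fderiv ℝ (fderiv ℝ L) z (0, e) (c, 0) - fderiv ℝ (fderiv ℝ L) z (0, c) (e, 0)) := by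
  have h0 := h.fderiv_eulerLagrange_eq hz (0, e) c
  -- The first component of `G` is `y`, so the fibre derivative in direction `e` has horizontal part
  -- `e`. It produces one of the two mixed Hessians of the antisymmetric bracket.
  have h5 : fderiv ℝ G z (0, e) = (e, 0) + (0, (fderiv ℝ G z (0, e)).2) := by
    refine Prod.ext ?_ ?_ <;> simp [h.fderiv_fst hz]
  rw [h5, map_add] at h0
  simp only [add_apply] at h0
  have s1 := h.fderiv_fderiv_fderiv_symm hz (0, e) (G z) (0, c)
  have s2 := fderiv_fderiv_symm h.isOpen h.smooth_lagrangian hz (0, c) (e, 0)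
  linarith

end IsLocalSpray

end LocalSpray

/-! ### The determinant of the metric and the divergence of the spray coefficients. -/

section Coordinates

variable {n : ℕ} {U : Set (Coord n × Coord n)} {L : Coord n × Coord n → ℝ}
  {G : Coord n × Coord n → Coord n × Coord n} {z : Coord n × Coord n}

lemma sum_smul_stdVec (a : Coord n) : ∑ i, a i • stdVec i = a := by
  ext j
  simp [stdVec, Pi.single_apply]

lemma clm_vert_eq_sum {W : Type*} [NormedAddCommGroup W] [NormedSpace ℝ W]
    (A : Coord n × Coord n →L[ℝ] W) (a : Coord n) :
    A (0, a) = ∑ i, a i • A (0, stdVec i) := by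
  have h : ((0 : Coord n), a) = ∑ i, a i • ((0 : Coord n), stdVec i) := by
    refine Prod.ext ?_ ?_
    · simp [Prod.fst_sum]
    · simp [Prod.snd_sum, sum_smul_stdVec]
  conv_lhs => rw [h, map_sum]
  simp only [map_smul]

/-- The vertical Hessian `∂²L/∂yⁱ∂yʲ`. -/
def vertHessian (L : Coord n × Coord n → ℝ) (z : Coord n × Coord n) : Matrix (Fin n) (Fin n) ℝ :=
  Matrix.of fun i j => fderiv ℝ (fderiv ℝ L) z (0, stdVec i) (0, stdVec j)

/-- The fibre derivative `∂Gⁱ/∂yʲ` of the vertical components of a field, at entry `(j, i)`. -/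
def vertJacobian (G : Coord n × Coord n → Coord n × Coord n) (z : Coord n × Coord n) :
    Matrix (Fin n) (Fin n) ℝ :=
  Matrix.of fun j i => (fderiv ℝ G z (0, stdVec j)).2 i

lemma nondegenerate_of_det_ne_zero (hdet : (vertHessian L z).det ≠ 0) (a : Coord n)
    (ha : ∀ d : Coord n, fderiv ℝ (fderiv ℝ L) z (0, d) (0, a) = 0) : a = 0 := by
  have h1 : (vertHessian L z).mulVec (fun i => a i) = 0 := by
    ext i
    have := ha (stdVec i)
    rw [clm_vert_eq_sum] at this
    simpa [Matrix.mulVec, dotProduct, vertHessian, mul_comm] using this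
  have h2 := Matrix.eq_zero_of_mulVec_eq_zero hdet h1
  ext i
  exact congrFun h2 i

lemma contDiffOn_vertHessian (hU : IsOpen U) (hL : ContDiffOn ℝ ∞ L U) (i j : Fin n) :
    ContDiffOn ℝ ∞ (fun w => vertHessian L w i j) U :=
  ((contDiffOn_fderiv hU (contDiffOn_fderiv hU hL)).clm_apply contDiffOn_const).clm_apply
    contDiffOn_const

lemma fderiv_vertHessian (hU : IsOpen U) (hL : ContDiffOn ℝ ∞ L U) (hz : z ∈ U) (i j : Fin n)
    (u : Coord n × Coord n) : fderiv ℝ (fun w => vertHessian L w i j) z u =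
      fderiv ℝ (fderiv ℝ (fderiv ℝ L)) z u (0, stdVec i) (0, stdVec j) := by
  have hf1 := contDiffOn_fderiv hU hL
  have hd2 := differentiableAt_of_contDiffOn hU (contDiffOn_fderiv hU hf1) hz
  simp only [vertHessian, Matrix.of_apply]
  rw [fderiv_clm_apply_const (hd2.clm_apply (differentiableAt_const _)),
    fderiv_clm_apply_const hd2]

namespace IsLocalSpray

/-- The entries of `g` are 0-homogeneous, so the derivative matrix in Jacobi's formula vanishes. -/
lemma fderiv_log_det_vert (h : IsLocalSpray U L G) (hz : z ∈ U)
    (hdet : (vertHessian L z).det ≠ 0) :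
    fderiv ℝ (fun w => Real.log (vertHessian L w).det) z (0, z.2) = 0 := by
  rw [fderiv_log_det (fun i j => differentiableAt_of_contDiffOn h.isOpen
    (contDiffOn_vertHessian h.isOpen h.smooth_lagrangian i j) hz) hdet]
  simp only [fderiv_vertHessian h.isOpen h.smooth_lagrangian hz, h.fderiv_metric_vert hz]
  have : (Matrix.of fun _ _ : Fin n => (0 : ℝ)) = 0 := rfl
  rw [this, mul_zero, Matrix.trace_zero]

/-- The logarithmic derivative of `det g` along the geodesic spray is `-∂Gⁱ/∂yⁱ`. -/
lemma fderiv_log_det_field (h : IsLocalSpray U L G) (hz : z ∈ U)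
    (hdet : (vertHessian L z).det ≠ 0) :
    fderiv ℝ (fun w => Real.log (vertHessian L w).det) z (G z) = -(vertJacobian G z).trace := by
  rw [fderiv_log_det (fun i j => differentiableAt_of_contDiffOn h.isOpen
    (contDiffOn_vertHessian h.isOpen h.smooth_lagrangian i j) hz) hdet]
  simp only [fderiv_vertHessian h.isOpen h.smooth_lagrangian hz, h.fderiv_metric_field hz]
  set g := vertHessian L z with hg
  -- The mixed derivatives `∂²L/∂yⁱ∂xʲ` appear only antisymmetrized, hence drop out of the trace
  -- against `g⁻¹`; what remains is the trace of a conjugate of `vertJacobian G z`.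
  let A : Matrix (Fin n) (Fin n) ℝ := Matrix.of fun i j =>
    fderiv ℝ (fderiv ℝ L) z (0, stdVec i) (stdVec j, 0)
      - fderiv ℝ (fderiv ℝ L) z (0, stdVec j) (stdVec i, 0)
  have hsymm : g.transpose = g := by
    ext i j
    exact fderiv_fderiv_symm h.isOpen h.smooth_lagrangian hz _ _
  have hA : A.transpose = -A := by
    ext i j
    simp [A]
  have hmat : (Matrix.of fun i j => -fderiv ℝ (fderiv ℝ L) z
      (0, (fderiv ℝ G z (0, stdVec i)).2) (0, stdVec j)
      + (fderiv ℝ (fderiv ℝ L) z (0, stdVec i) (stdVec j, 0)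
        - fderiv ℝ (fderiv ℝ L) z (0, stdVec j) (stdVec i, 0)))
      = -(vertJacobian G z * g) + A := by
    ext i j
    simp only [Matrix.of_apply, Matrix.add_apply, Matrix.neg_apply, Matrix.mul_apply, A]
    rw [clm_vert_eq_sum (fderiv ℝ (fderiv ℝ L) z)]
    simp [vertJacobian, hg, vertHessian]
  have hginv : g⁻¹.transpose = g⁻¹ := by rw [Matrix.transpose_nonsing_inv, hsymm]
  rw [hmat, Matrix.mul_add, Matrix.trace_add, trace_mul_eq_zero_of_transpose_eq_neg hginv hA,
    add_zero, Matrix.mul_neg, Matrix.trace_neg, Matrix.trace_mul_comm, Matrix.mul_assoc,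
    Matrix.mul_nonsing_inv _ (isUnit_iff_ne_zero.2 hdet), mul_one]

end IsLocalSpray

/-- The effect of a projective deformation on the trace of the fibre derivative. -/
lemma trace_vertJacobian_projective {G' : Coord n × Coord n → Coord n × Coord n}
    {P : Coord n × Coord n → ℝ} (hU : IsOpen U) (hz : z ∈ U) (hG : DifferentiableAt ℝ G z)
    (hP : DifferentiableAt ℝ P z) (hhom : fderiv ℝ P z (0, z.2) = P z)
    (hG' : ∀ w ∈ U, G' w = G w - (2 * P w) • ((0 : Coord n), w.2)) :
    (vertJacobian G' z).trace = (vertJacobian G z).trace - 2 * ((n : ℝ) + 1) * P z := by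
  have h1 : fderiv ℝ G' z = fderiv ℝ (fun w => G w - (2 * P w) • ((0 : Coord n), w.2)) z := by
    apply Filter.EventuallyEq.fderiv_eq
    filter_upwards [hU.mem_nhds hz] with w hw using hG' w hw
  -- The product rule on `P yʲ` gives `P` in each of the `n` diagonal entries, and the terms `yʲ
  -- ∂P/∂yʲ` add up to one more `P` by Euler's relation: this is the constant `n + 1`.
  have h2 : ∀ j, vertJacobian G' z j j = vertJacobian G z j j
      - 2 * (P z + z.2 j * fderiv ℝ P z (0, stdVec j)) := by
    intro j
    simp only [vertJacobian, Matrix.of_apply, h1]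
    rw [fderiv_fun_sub hG (DifferentiableAt.fun_smul (hP.const_mul 2) differentiableAt_vert),
      fderiv_fun_smul (hP.const_mul 2) differentiableAt_vert, fderiv_const_mul hP]
    simp [fderiv_vert, stdVec]
    ring
  simp only [Matrix.trace, Matrix.diag, h2, Finset.sum_sub_distrib, ← Finset.mul_sum,
    Finset.sum_add_distrib]
  rw [clm_vert_eq_sum] at hhom
  simp only [smul_eq_mul] at hhom
  rw [hhom]
  simp
  ring

/-- The distortion in coordinates. -/
def localDistortion (L : Coord n × Coord n → ℝ) (σ : Coord n → ℝ) (z : Coord n × Coord n) : ℝ :=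
  (1 / 2 : ℝ) * Real.log ((vertHessian L z).det / σ z.1)

/-! ### The distortion in a single chart. -/

section Distortion

variable {σ : Coord n → ℝ} {B : Set (Coord n)}

lemma contDiffOn_localDistortion (hU : IsOpen U) (hL : ContDiffOn ℝ ∞ L U)
    (hdet : ∀ z ∈ U, (vertHessian L z).det ≠ 0) (hUB : ∀ z ∈ U, z.1 ∈ B)
    (hσ : ContDiffOn ℝ ∞ σ B) (hpos : ∀ x ∈ B, 0 < σ x) :
    ContDiffOn ℝ ∞ (localDistortion L σ) U := by
  have h1 : ContDiffOn ℝ ∞ (fun z : Coord n × Coord n => σ z.1) U :=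
    hσ.comp contDiffOn_fst hUB
  exact contDiffOn_const.mul (((contDiffOn_det (contDiffOn_vertHessian hU hL)).div h1
    fun z hz => (hpos _ (hUB z hz)).ne').log fun z hz =>
      div_ne_zero (hdet z hz) (hpos _ (hUB z hz)).ne')

/-- The density `σ` lives on the base, so its term sees only `u.1` and vanishes along the fibres. -/
lemma fderiv_localDistortion (hU : IsOpen U) (hL : ContDiffOn ℝ ∞ L U)
    (hdet : ∀ z ∈ U, (vertHessian L z).det ≠ 0) (hB : IsOpen B) (hUB : ∀ z ∈ U, z.1 ∈ B)
    (hσ : ContDiffOn ℝ ∞ σ B) (hpos : ∀ x ∈ B, 0 < σ x) (hz : z ∈ U) (u : Coord n × Coord n) :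
    fderiv ℝ (localDistortion L σ) z u = (1 / 2 : ℝ) *
      (fderiv ℝ (fun w => Real.log (vertHessian L w).det) z u
        - fderiv ℝ (fun x => Real.log (σ x)) z.1 u.1) := by
  have h1 : fderiv ℝ (localDistortion L σ) z = fderiv ℝ (fun w => (1 / 2 : ℝ) *
      (Real.log (vertHessian L w).det - Real.log (σ w.1))) z := by
    apply Filter.EventuallyEq.fderiv_eq
    filter_upwards [hU.mem_nhds hz] with w hw
    rw [localDistortion, Real.log_div (hdet w hw) (hpos _ (hUB w hw)).ne']
  have hd1 : DifferentiableAt ℝ (fun w => Real.log (vertHessian L w).det) z :=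
    (differentiableAt_of_contDiffOn hU (contDiffOn_det (contDiffOn_vertHessian hU hL)) hz).log
      (hdet z hz)
  have hd2 : DifferentiableAt ℝ (fun x => Real.log (σ x)) z.1 :=
    (differentiableAt_of_contDiffOn hB hσ (hUB z hz)).log (hpos _ (hUB z hz)).ne'
  have hd3 := hd2.hasFDerivAt.comp z (hasFDerivAt_fst (𝕜 := ℝ) (p := z))
  rw [h1.trans ((hd1.hasFDerivAt.sub hd3).const_mul (1 / 2 : ℝ)).fderiv]
  simp

namespace IsLocalSpray

/-- The distortion is 0-homogeneous. -/
lemma fderiv_localDistortion_vert (h : IsLocalSpray U L G)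
    (hdet : ∀ z ∈ U, (vertHessian L z).det ≠ 0) (hB : IsOpen B) (hUB : ∀ z ∈ U, z.1 ∈ B)
    (hσ : ContDiffOn ℝ ∞ σ B) (hpos : ∀ x ∈ B, 0 < σ x) (hz : z ∈ U) :
    fderiv ℝ (localDistortion L σ) z (0, z.2) = 0 := by
  rw [fderiv_localDistortion h.isOpen h.smooth_lagrangian hdet hB hUB hσ hpos hz,
    h.fderiv_log_det_vert hz (hdet z hz)]
  simp

/-- The `S`-function in coordinates, in terms of the divergence of the spray coefficients. -/
lemma fderiv_localDistortion_field (h : IsLocalSpray U L G)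
    (hdet : ∀ z ∈ U, (vertHessian L z).det ≠ 0) (hB : IsOpen B) (hUB : ∀ z ∈ U, z.1 ∈ B)
    (hσ : ContDiffOn ℝ ∞ σ B) (hpos : ∀ x ∈ B, 0 < σ x) (hz : z ∈ U) :
    fderiv ℝ (localDistortion L σ) z (G z) = -(1 / 2 : ℝ) * ((vertJacobian G z).trace
      + fderiv ℝ (fun x => Real.log (σ x)) z.1 z.2) := by
  rw [fderiv_localDistortion h.isOpen h.smooth_lagrangian hdet hB hUB hσ hpos hz,
    h.fderiv_log_det_field hz (hdet z hz), h.fst_eq hz]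
  ring

/-- The derivative of a 0-homogeneous function along a geodesic spray is 1-homogeneous. -/
lemma fderiv_field_vert (h : IsLocalSpray U L G) {τ : Coord n × Coord n → ℝ}
    (hτ : ContDiffOn ℝ ∞ τ U) (hhom : ∀ z ∈ U, fderiv ℝ τ z (0, z.2) = 0) (hz : z ∈ U) :
    fderiv ℝ (fun w => fderiv ℝ τ w (G w)) z (0, z.2) = fderiv ℝ τ z (G z) := by
  have hd1 := differentiableAt_of_contDiffOn h.isOpen (contDiffOn_fderiv h.isOpen hτ) hz
  have hG := differentiableAt_of_contDiffOn h.isOpen h.smooth_field hz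
  have h1 := euler_fderiv (p := 0) h.isOpen hτ (fun z hz => by rw [hhom z hz, zero_mul]) hz (G z)
  have h2 := fderiv_fderiv_symm h.isOpen hτ hz (0, z.2) (G z)
  -- This is `[𝒞, G] = G` in coordinates; the extra `(0, (G z).2)` cancels against the
  -- differentiated Euler relation of degree 0.
  have h3 : (z.2, (2 : ℝ) • (G z).2) = G z + (0, (G z).2) :=
    Prod.ext (by simp [h.fst_eq hz]) (by simp [two_smul])
  rw [fderiv_clm_apply hd1 hG]
  simp only [add_apply, ContinuousLinearMap.comp_apply, ContinuousLinearMap.flip_apply,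
    h.fderiv_vert hz, h3, map_add]
  linarith

end IsLocalSpray

end Distortion

end Coordinates

/-! ### Natural charts of `TM` and the canonical structures read in them. -/

section Domain

variable {n : ℕ} {M : Type*} [TopologicalSpace M] [ChartedSpace (Coord n) M] {x₀ : M}

/-- The part of `TM` covered by the natural chart around `x₀`. -/
def natSource (x₀ : M) : Set (TangentBundle (𝓡 n) M) :=
  {v | v.proj ∈ (chartAt (Coord n) x₀).source}

/-- The coordinate domain of the natural chart around `x₀`, with the zero section removed. -/
def natDomain (x₀ : M) : Set (Coord n × Coord n) :=
  {z | z.1 ∈ (chartAt (Coord n) x₀).target ∧ z.2 ≠ 0}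

lemma isOpen_natDomain : IsOpen (natDomain (n := n) x₀) :=
  ((chartAt (Coord n) x₀).open_target.preimage continuous_fst).inter
    (isOpen_compl_singleton.preimage continuous_snd)

lemma mem_natSource_proj (v : TangentBundle (𝓡 n) M) : v ∈ natSource v.proj :=
  mem_chart_source _ _

end Domain

section Charts

variable {n : ℕ} {M : Type*} [TopologicalSpace M] [ChartedSpace (Coord n) M]
  [IsManifold (𝓡 n) ∞ M] {x₀ x₁ : M} {v : TangentBundle (𝓡 n) M} {z : Coord n × Coord n}

/-- The isomorphism `T_xM → ℝⁿ` induced by the chart around `x₀`. -/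
def fibreMap (x₀ x : M) : TangentSpace (𝓡 n) x →L[ℝ] Coord n :=
  mfderiv (𝓡 n) 𝓘(ℝ, Coord n) (extChartAt (𝓡 n) x₀) x

/-- The differential of the natural chart around `x₀`. -/
def natDeriv (x₀ : M) (v : TangentBundle (𝓡 n) M) :
    TangentSpace (𝓡 n).tangent v →L[ℝ] (Coord n × Coord n) :=
  mfderiv (𝓡 n).tangent 𝓘(ℝ, Coord n × Coord n) (natChart x₀) v

lemma natChart_source : (natChart x₀).source = natSource (n := n) x₀ := by
  ext v
  simp [natChart, natSource]

lemma mem_natChart_target : z ∈ (natChart (n := n) x₀).target ↔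
    z.1 ∈ (chartAt (Coord n) x₀).target := by
  rw [natChart, extChartAt_target, ModelWithCorners.range_eq_univ, Set.inter_univ]
  exact TangentBundle.mem_chart_target_iff z (⟨x₀, 0⟩ : TangentBundle (𝓡 n) M)

lemma natChart_apply (hv : v ∈ natSource x₀) :
    natChart x₀ v = (chartAt (Coord n) x₀ v.proj, fibreMap x₀ v.proj v.2) := by
  -- `mfderiv` is a conditional on differentiability; on the chart source it takes the value
  -- `fderivWithin` that the tangent bundle chart uses.
  have h : fibreMap x₀ v.proj = fderivWithin ℝ (writtenInExtChartAt (𝓡 n) 𝓘(ℝ, Coord n) v.proj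
      (extChartAt (𝓡 n) x₀)) (Set.range (𝓡 n)) (extChartAt (𝓡 n) v.proj v.proj) :=
    if_pos (mdifferentiableAt_extChartAt hv)
  exact Prod.ext rfl (DFunLike.congr_fun h v.2).symm

lemma natChart_apply_mk {x : M} (hx : x ∈ (chartAt (Coord n) x₀).source)
    (w : TangentSpace (𝓡 n) x) :
    natChart x₀ (⟨x, w⟩ : TangentBundle (𝓡 n) M) =
      (chartAt (Coord n) x₀ x, fibreMap x₀ x w) :=
  natChart_apply (v := ⟨x, w⟩) hx

lemma fibreMap_isInvertible {x : M} (hx : x ∈ (chartAt (Coord n) x₀).source) :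
    (fibreMap (n := n) x₀ x).IsInvertible :=
  isInvertible_mfderiv_extChartAt (by simpa using hx)

lemma isOpen_natSource : IsOpen (natSource (n := n) x₀) := by
  rw [← natChart_source]
  exact isOpen_extChartAt_source _

lemma natChart_mem_natDomain (hv : v ∈ natSource x₀) (h0 : v ∈ slit n M) :
    natChart x₀ v ∈ natDomain x₀ := by
  rw [natChart_apply hv]
  refine ⟨(chartAt (Coord n) x₀).map_source hv, fun h => h0 ?_⟩
  exact (fibreMap_isInvertible hv).injective (h.trans (map_zero _).symm)

lemma natChart_symm_mem_natSource (hz : z ∈ natDomain (n := n) x₀) :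
    (natChart x₀).symm z ∈ natSource (n := n) x₀ := by
  rw [← natChart_source]
  exact (natChart x₀).map_target (mem_natChart_target.2 hz.1)

lemma natChart_natChart_symm (hz : z ∈ natDomain (n := n) x₀) :
    natChart x₀ ((natChart (n := n) x₀).symm z) = z :=
  (natChart x₀).right_inv (mem_natChart_target.2 hz.1)

lemma natChart_symm_natChart (hv : v ∈ natSource x₀) :
    (natChart x₀).symm (natChart x₀ v) = v :=
  (natChart x₀).left_inv (by rwa [natChart_source])

lemma natChart_symm_mem_slit (hz : z ∈ natDomain (n := n) x₀) :
    (natChart x₀).symm z ∈ slit n M := by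
  intro h
  have h1 := natChart_natChart_symm hz
  rw [natChart_apply (natChart_symm_mem_natSource hz), h, map_zero] at h1
  exact hz.2 (congrArg Prod.snd h1).symm

lemma contMDiffOn_natChart : ContMDiffOn (𝓡 n).tangent 𝓘(ℝ, Coord n × Coord n) ∞
    (natChart x₀) (natSource (n := n) x₀) := by
  have := contMDiffOn_extChartAt (I := (𝓡 n).tangent) (n := ∞)
    (x := (⟨x₀, 0⟩ : TangentBundle (𝓡 n) M))
  rwa [← extChartAt_source (𝓡 n).tangent, ← natChart, natChart_source] at this

lemma contMDiffOn_natChart_symm : ContMDiffOn 𝓘(ℝ, Coord n × Coord n) (𝓡 n).tangent ∞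
    (natChart (n := n) x₀).symm (natDomain (n := n) x₀) :=
  (contMDiffOn_extChartAt_symm (I := (𝓡 n).tangent) (n := ∞)
    (⟨x₀, 0⟩ : TangentBundle (𝓡 n) M)).mono fun _ hz => mem_natChart_target.2 hz.1

lemma isOpen_slit : IsOpen (slit n M) := by
  rw [isOpen_iff_mem_nhds]
  intro v hv
  have hs : v ∈ natSource v.proj := mem_chart_source _ _
  have h1 : ContinuousAt (natChart v.proj) v :=
    (contMDiffOn_natChart.contMDiffAt (isOpen_natSource.mem_nhds hs)).continuousAt
  filter_upwards [isOpen_natSource.mem_nhds hs,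
    h1.preimage_mem_nhds (isOpen_natDomain.mem_nhds (natChart_mem_natDomain hs hv))]
    with w hw hwd
  have := natChart_symm_mem_slit hwd
  rwa [natChart_symm_natChart hw] at this

lemma mdifferentiableAt_natChart (hv : v ∈ natSource x₀) :
    MDifferentiableAt (𝓡 n).tangent 𝓘(ℝ, Coord n × Coord n) (natChart x₀) v :=
  (contMDiffOn_natChart.contMDiffAt (isOpen_natSource.mem_nhds hv)).mdifferentiableAt (by simp)

lemma mdifferentiableAt_natChart_symm (hz : z ∈ natDomain (n := n) x₀) :
    MDifferentiableAt 𝓘(ℝ, Coord n × Coord n) (𝓡 n).tangent (natChart (n := n) x₀).symm z :=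
  (contMDiffOn_natChart_symm.contMDiffAt (isOpen_natDomain.mem_nhds hz)).mdifferentiableAt
    (by simp)

lemma coordFrame_natDeriv (hv : v ∈ natSource x₀) (h0 : v ∈ slit n M)
    (ξ : TangentSpace (𝓡 n).tangent v) :
    coordFrame x₀ v (natDeriv x₀ v ξ) = ξ := by
  have h1 := mfderiv_comp v (mdifferentiableAt_natChart_symm (natChart_mem_natDomain hv h0))
    (mdifferentiableAt_natChart hv)
  have h2 : (natChart x₀).symm ∘ natChart x₀ =ᶠ[nhds v] id := by
    filter_upwards [isOpen_natSource.mem_nhds hv] with w hw using natChart_symm_natChart hw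
  rw [h2.mfderiv_eq, mfderiv_id] at h1
  exact (DFunLike.congr_fun h1 ξ).symm

lemma natDeriv_coordFrame (hv : v ∈ natSource x₀) (h0 : v ∈ slit n M)
    (u : Coord n × Coord n) :
    natDeriv x₀ v (coordFrame x₀ v u) = u := by
  have hz := natChart_mem_natDomain hv h0
  have h1 := mfderiv_comp_of_eq (mdifferentiableAt_natChart hv)
    (mdifferentiableAt_natChart_symm hz) (natChart_symm_natChart hv)
  have h2 : natChart x₀ ∘ (natChart (n := n) x₀).symm =ᶠ[nhds (natChart x₀ v)] id := by
    filter_upwards [(isOpen_natDomain (n := n)).mem_nhds hz] with w hw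
      using natChart_natChart_symm hw
  rw [h2.mfderiv_eq, mfderiv_id] at h1
  -- The chain rule produces the base point `(natChart x₀).symm (natChart x₀ v)`, which is equal to
  -- `v` but not definitionally. Generalizing it to `w` makes the passage between the two tangent
  -- spaces a substitution.
  have h3 : ∀ w : TangentBundle (𝓡 n) M, w = v →
      natDeriv x₀ w (coordFrame x₀ v u) = natDeriv x₀ v (coordFrame x₀ v u) := by
    rintro w rfl
    rfl
  exact (h3 _ (natChart_symm_natChart hv)).symm.trans (DFunLike.congr_fun h1 u).symm

/-- Needed because the `mfderiv` in `verticalLift` would be zero by default at a point of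
non-differentiability. -/
lemma contMDiff_fibre_inclusion (x : M) : ContMDiff 𝓘(ℝ, Coord n) (𝓡 n).tangent ∞
    (fun w : Coord n => (⟨x, w⟩ : TangentBundle (𝓡 n) M)) := by
  intro w
  rw [Bundle.contMDiffAt_totalSpace]
  refine ⟨contMDiffAt_const, ?_⟩
  have h : (fun w : Coord n => (trivializationAt (Coord n) (TangentSpace (𝓡 n) : M → Type _) x
      (⟨x, w⟩ : TangentBundle (𝓡 n) M)).2) = fun w => fibreMap x x w :=
    funext fun w => congrArg Prod.snd (natChart_apply_mk (mem_chart_source _ x) w)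
  change ContMDiffAt _ _ _ (fun w : Coord n => (trivializationAt (Coord n)
    (TangentSpace (𝓡 n) : M → Type _) x (⟨x, w⟩ : TangentBundle (𝓡 n) M)).2) w
  rw [h]
  let A : Coord n →L[ℝ] Coord n := fibreMap x x
  exact (contMDiffAt_iff_contDiffAt.2 A.contDiff.contDiffAt :
    ContMDiffAt 𝓘(ℝ, Coord n) 𝓘(ℝ, Coord n) ∞ A w)

/-- In a natural chart the inclusion of a fibre is constant in the first component and linear in the
second. -/
lemma natDeriv_verticalLift (hv : v ∈ natSource x₀) (w : TangentSpace (𝓡 n) v.proj) :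
    natDeriv x₀ v (verticalLift v w) = (0, fibreMap x₀ v.proj w) := by
  have h1 := mfderiv_comp (I' := (𝓡 n).tangent)
    (f := fun w : Coord n => (⟨v.proj, w⟩ : TangentBundle (𝓡 n) M))
    (g := natChart x₀) v.2 (mdifferentiableAt_natChart hv)
    ((contMDiff_fibre_inclusion v.proj).mdifferentiableAt (by simp))
  let A : Coord n →L[ℝ] Coord n := fibreMap x₀ v.proj
  have h2 : natChart x₀ ∘ (fun w : Coord n => (⟨v.proj, w⟩ : TangentBundle (𝓡 n) M)) =
      fun w : Coord n => (chartAt (Coord n) x₀ v.proj, A w) :=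
    funext fun w => natChart_apply_mk hv w
  have h3 : HasFDerivAt (fun w : Coord n => (chartAt (Coord n) x₀ v.proj, A w))
      ((0 : Coord n →L[ℝ] Coord n).prod A) (v.2 : Coord n) :=
    (hasFDerivAt_const _ _).prodMk A.hasFDerivAt
  rw [h2] at h1
  exact (DFunLike.congr_fun (h3.hasMFDerivAt.mfderiv.symm.trans h1) w).symm

/-- Both sides differentiate the base chart composed with the projection, which is also `Prod.fst ∘
natChart x₀`. -/
lemma fibreMap_mfderiv_proj (hv : v ∈ natSource x₀) (ξ : TangentSpace (𝓡 n).tangent v) :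
    fibreMap x₀ v.proj (mfderiv (𝓡 n).tangent (𝓡 n)
      (fun w : TangentBundle (𝓡 n) M => w.proj) v ξ) = (natDeriv x₀ v ξ).1 := by
  have hd := mdifferentiableAt_natChart hv
  have h1 := mfderiv_comp v (I' := 𝓡 n) (mdifferentiableAt_extChartAt (I := 𝓡 n) hv)
    ((Bundle.contMDiff_proj (n := ∞) (IB := 𝓡 n) (F := Coord n)
      (TangentSpace (𝓡 n) : M → Type _)).mdifferentiableAt (x := v) (by simp))
  have h2 : extChartAt (𝓡 n) x₀ ∘ (fun w : TangentBundle (𝓡 n) M => w.proj) =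
      Prod.fst ∘ natChart x₀ := rfl
  have h3 := mfderiv_comp v (I' := 𝓘(ℝ, Coord n × Coord n)) (I'' := 𝓘(ℝ, Coord n))
    (g := Prod.fst)
    (differentiableAt_fst (𝕜 := ℝ) (p := natChart x₀ v)).mdifferentiableAt hd
  rw [mfderiv_eq_fderiv, fderiv_fst] at h3
  exact DFunLike.congr_fun (h1.symm.trans h3) ξ

lemma natDeriv_tangentEndo (hv : v ∈ natSource x₀) (ξ : TangentSpace (𝓡 n).tangent v) :
    natDeriv x₀ v (tangentEndo v ξ) = (0, (natDeriv x₀ v ξ).1) := by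
  rw [← fibreMap_mfderiv_proj hv, ← natDeriv_verticalLift hv]
  rfl

lemma natDeriv_liouville (hv : v ∈ natSource x₀) :
    natDeriv x₀ v (liouville v) = (0, (natChart x₀ v).2) := by
  rw [natChart_apply hv, liouville, natDeriv_verticalLift hv]

end Charts

/-! ### Functions, vector fields and 1-forms in natural charts. -/

section Representations

variable {n : ℕ} {M : Type*} [TopologicalSpace M] [ChartedSpace (Coord n) M]
  [IsManifold (𝓡 n) ∞ M] {x₀ x₁ : M} {v : TangentBundle (𝓡 n) M} {z : Coord n × Coord n}
  {f : TangentBundle (𝓡 n) M → ℝ}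
  {X : ∀ v : TangentBundle (𝓡 n) M, TangentSpace (𝓡 n).tangent v}
  {α : ∀ v : TangentBundle (𝓡 n) M, TangentSpace (𝓡 n).tangent v →L[ℝ] ℝ}

/-- A function on `TM` read in the natural chart around `x₀`. -/
def localFun (f : TangentBundle (𝓡 n) M → ℝ) (x₀ : M) (z : Coord n × Coord n) : ℝ :=
  f ((natChart x₀).symm z)

/-- A vector field on `TM` read in the natural chart around `x₀`. -/
def localField (X : ∀ v : TangentBundle (𝓡 n) M, TangentSpace (𝓡 n).tangent v) (x₀ : M)
    (z : Coord n × Coord n) : Coord n × Coord n :=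
  natDeriv x₀ ((natChart x₀).symm z) (X ((natChart x₀).symm z))

lemma localFun_natChart (f : TangentBundle (𝓡 n) M → ℝ) (hv : v ∈ natSource x₀) :
    localFun f x₀ (natChart x₀ v) = f v := by
  rw [localFun, natChart_symm_natChart hv]

lemma localField_natChart (X : ∀ v : TangentBundle (𝓡 n) M, TangentSpace (𝓡 n).tangent v)
    (hv : v ∈ natSource x₀) :
    localField X x₀ (natChart x₀ v) = natDeriv x₀ v (X v) := by
  rw [localField, natChart_symm_natChart hv]

lemma SmoothFun.contDiffOn (hf : SmoothFun f) (x₀ : M) :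
    ContDiffOn ℝ ∞ (localFun f x₀) (natDomain x₀) :=
  contMDiffOn_iff_contDiffOn.1 <|
    ContMDiffOn.comp hf contMDiffOn_natChart_symm fun _ hz => natChart_symm_mem_slit hz

lemma smoothFun_of_contDiffAt
    (hf : ∀ v ∈ slit n M, ContDiffAt ℝ ∞ (localFun f v.proj) (natChart v.proj v)) :
    SmoothFun f := by
  intro v hv
  have h1 := ((hf v hv).contMDiffAt.comp v (contMDiffOn_natChart.contMDiffAt
    (isOpen_natSource.mem_nhds (mem_natSource_proj v))))
  refine (h1.congr_of_eventuallyEq ?_).contMDiffWithinAt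
  filter_upwards [isOpen_natSource.mem_nhds (mem_natSource_proj v)] with w hw
  exact (localFun_natChart f hw).symm

lemma SmoothFun.of_contDiffOn (hf : ∀ x₀, ContDiffOn ℝ ∞ (localFun f x₀) (natDomain x₀)) :
    SmoothFun f :=
  smoothFun_of_contDiffAt fun v hv => (hf v.proj).contDiffAt
    (isOpen_natDomain.mem_nhds (natChart_mem_natDomain (mem_natSource_proj v) hv))

/-- Differentiability at one point suffices, so the formula also covers the contraction of `d_J f`
with a semispray, which is only known near the point. -/
lemma diff_eq_of_differentiableAt (hv : v ∈ natSource x₀)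
    (hf : DifferentiableAt ℝ (localFun f x₀) (natChart x₀ v))
    (ξ : TangentSpace (𝓡 n).tangent v) :
    diff f v ξ = fderiv ℝ (localFun f x₀) (natChart x₀ v) (natDeriv x₀ v ξ) := by
  have h1 := mfderiv_comp v hf.mdifferentiableAt (mdifferentiableAt_natChart hv)
  have h2 : localFun f x₀ ∘ natChart x₀ =ᶠ[nhds v] f := by
    filter_upwards [isOpen_natSource.mem_nhds hv] with w hw using localFun_natChart f hw
  rw [h2.mfderiv_eq, mfderiv_eq_fderiv] at h1
  exact DFunLike.congr_fun h1 ξ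

lemma SmoothFun.diff_eq (hf : SmoothFun f) (hv : v ∈ natSource x₀) (h0 : v ∈ slit n M)
    (ξ : TangentSpace (𝓡 n).tangent v) :
    diff f v ξ = fderiv ℝ (localFun f x₀) (natChart x₀ v) (natDeriv x₀ v ξ) :=
  diff_eq_of_differentiableAt hv (differentiableAt_of_contDiffOn isOpen_natDomain
    (hf.contDiffOn x₀) (natChart_mem_natDomain hv h0)) ξ

lemma SmoothFun.act_eq (hf : SmoothFun f) (hv : v ∈ natSource x₀) (h0 : v ∈ slit n M) :
    act X f v = fderiv ℝ (localFun f x₀) (natChart x₀ v) (localField X x₀ (natChart x₀ v)) := by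
  rw [act, hf.diff_eq hv h0, localField_natChart X hv]

lemma SmoothFun.localFun_act (hf : SmoothFun f) (hz : z ∈ natDomain x₀) :
    localFun (act X f) x₀ z = fderiv ℝ (localFun f x₀) z (localField X x₀ z) := by
  rw [localFun, hf.act_eq (natChart_symm_mem_natSource hz) (natChart_symm_mem_slit hz),
    natChart_natChart_symm hz]

lemma SmoothField.contDiffOn (hX : SmoothField X) (x₀ : M) :
    ContDiffOn ℝ ∞ (localField X x₀) (natDomain x₀) := by
  let p : TangentBundle (𝓡 n) M := ⟨x₀, 0⟩
  let e := trivializationAt (Coord n × Coord n) (TangentSpace (𝓡 n).tangent) p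
  have hsrc : ∀ v ∈ natSource x₀, v ∈ (chartAt (ModelProd (Coord n) (Coord n)) p).source :=
    fun v hv => (TangentBundle.mem_chart_source_iff v p).2 hv
  have h1 : ContMDiffOn (𝓡 n).tangent 𝓘(ℝ, Coord n × Coord n) ∞ (fun v => (e ⟨v, X v⟩).2)
      (slit n M ∩ natSource x₀) :=
    (e.contMDiffOn_section_iff (isOpen_slit.inter isOpen_natSource)
      fun v hv => hsrc v hv.2).1 (hX.mono Set.inter_subset_left)
  have h2 : ContMDiffOn (𝓡 n).tangent 𝓘(ℝ, Coord n × Coord n) ∞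
      (fun v => natDeriv x₀ v (X v)) (slit n M ∩ natSource x₀) := by
    refine h1.congr fun v hv => ?_
    -- Over the chart source, the trivialization of `T(TM)` at `⟨x₀, 0⟩` is the differential of the
    -- natural chart.
    have h3 := TangentBundle.continuousLinearMapAt_trivializationAt (I := (𝓡 n).tangent)
      (hsrc v hv.2)
    rw [natDeriv, natChart, ← h3, Bundle.Trivialization.continuousLinearMapAt_apply,
      Bundle.Trivialization.coe_linearMapAt_of_mem _ (hsrc v hv.2)]
  exact contMDiffOn_iff_contDiffOn.1 <| h2.comp contMDiffOn_natChart_symm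
    fun z hz => ⟨natChart_symm_mem_slit hz, natChart_symm_mem_natSource hz⟩

lemma SmoothFun.act (hf : SmoothFun f) (hX : SmoothField X) : SmoothFun (act X f) :=
  SmoothFun.of_contDiffOn fun x₀ =>
    ((contDiffOn_fderiv isOpen_natDomain (hf.contDiffOn x₀)).clm_apply (hX.contDiffOn x₀)).congr
      fun _ hz => hf.localFun_act hz

lemma localForm_natChart (α : ∀ v : TangentBundle (𝓡 n) M, TangentSpace (𝓡 n).tangent v →L[ℝ] ℝ)
    (hv : v ∈ natSource x₀) (u : Coord n × Coord n) :
    localForm α x₀ (natChart x₀ v) u = α v (coordFrame x₀ v u) := by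
  have h : ∀ w : TangentBundle (𝓡 n) M, w = v →
      α w (coordFrame x₀ v u) = α v (coordFrame x₀ v u) := by
    rintro w rfl
    rfl
  exact h _ (natChart_symm_natChart hv)

lemma localForm_natDeriv (α : ∀ v : TangentBundle (𝓡 n) M, TangentSpace (𝓡 n).tangent v →L[ℝ] ℝ)
    (hv : v ∈ natSource x₀) (h0 : v ∈ slit n M) (ξ : TangentSpace (𝓡 n).tangent v) :
    localForm α x₀ (natChart x₀ v) (natDeriv x₀ v ξ) = α v ξ := by
  rw [localForm_natChart α hv, coordFrame_natDeriv hv h0]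

/-- The tangent endomorphism in coordinates. -/
def verticalShift (n : ℕ) : (Coord n × Coord n) →L[ℝ] (Coord n × Coord n) :=
  (ContinuousLinearMap.inr ℝ (Coord n) (Coord n)).comp (ContinuousLinearMap.fst ℝ _ _)

lemma verticalShift_apply (u : Coord n × Coord n) : verticalShift n u = (0, u.1) := rfl

/-- The 1-form `d_J f` in coordinates. -/
lemma localForm_vertDiff (hf : SmoothFun f) (hz : z ∈ natDomain x₀) :
    localForm (vertDiff f) x₀ z = (fderiv ℝ (localFun f x₀) z).comp
      (verticalShift n) := by
  refine ContinuousLinearMap.ext fun u => ?_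
  have hv := natChart_symm_mem_natSource (n := n) hz
  have h0 := natChart_symm_mem_slit (n := n) hz
  have h1 := localForm_natChart (vertDiff f) hv u
  rw [natChart_natChart_symm hz] at h1
  rw [h1, vertDiff, ContinuousLinearMap.comp_apply, hf.diff_eq hv h0, natDeriv_tangentEndo hv,
    natDeriv_coordFrame hv h0, natChart_natChart_symm hz]
  rfl

/-- The transition between two natural charts. -/
def natTransition (n : ℕ) {M : Type*} [TopologicalSpace M] [ChartedSpace (Coord n) M]
    [IsManifold (𝓡 n) ∞ M] (x₀ x₁ : M) (z : Coord n × Coord n) : Coord n × Coord n :=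
  natChart x₁ ((natChart (n := n) x₀).symm z)

lemma natTransition_natChart (hv : v ∈ natSource x₀) :
    natTransition n x₀ x₁ (natChart x₀ v) = natChart x₁ v := by
  rw [natTransition, natChart_symm_natChart hv]

/-- The domain of the transition between two natural charts. -/
def transDomain (x₀ x₁ : M) : Set (Coord n × Coord n) :=
  natDomain x₀ ∩ (natChart x₀).symm ⁻¹' natSource x₁

lemma isOpen_transDomain : IsOpen (transDomain (n := n) x₀ x₁) :=
  contMDiffOn_natChart_symm.continuousOn.isOpen_inter_preimage isOpen_natDomain isOpen_natSource

lemma natChart_mem_transDomain (hv₀ : v ∈ natSource x₀) (hv₁ : v ∈ natSource x₁)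
    (h0 : v ∈ slit n M) : natChart x₀ v ∈ transDomain x₀ x₁ :=
  ⟨natChart_mem_natDomain hv₀ h0, by
    rwa [Set.mem_preimage, natChart_symm_natChart hv₀]⟩

lemma contDiffOn_natTransition :
    ContDiffOn ℝ ∞ (natTransition n x₀ x₁) (transDomain x₀ x₁) := by
  have h := (contMDiffOn_natChart_symm (n := n) (x₀ := x₀)).mono
    (Set.inter_subset_left : transDomain x₀ x₁ ⊆ natDomain x₀)
  exact contMDiffOn_iff_contDiffOn.1 <| (contMDiffOn_natChart (x₀ := x₁)).comp h fun _ hz => hz.2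

lemma fderiv_natTransition (hv₀ : v ∈ natSource x₀) (hv₁ : v ∈ natSource x₁)
    (h0 : v ∈ slit n M) (u : Coord n × Coord n) :
    fderiv ℝ (natTransition n x₀ x₁) (natChart x₀ v) u = natDeriv x₁ v (coordFrame x₀ v u) := by
  have h1 := mfderiv_comp_of_eq (mdifferentiableAt_natChart hv₁)
    (mdifferentiableAt_natChart_symm (natChart_mem_natDomain hv₀ h0)) (natChart_symm_natChart hv₀)
  have h2 : natChart x₁ ∘ (natChart (n := n) x₀).symm = natTransition n x₀ x₁ := rfl
  rw [h2, mfderiv_eq_fderiv] at h1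
  have h3 : ∀ w : TangentBundle (𝓡 n) M, w = v →
      natDeriv x₁ w (coordFrame x₀ v u) = natDeriv x₁ v (coordFrame x₀ v u) := by
    rintro w rfl
    rfl
  exact (DFunLike.congr_fun h1 u).trans (h3 _ (natChart_symm_natChart hv₀))

lemma fderiv_natTransition_natDeriv (hv₀ : v ∈ natSource x₀) (hv₁ : v ∈ natSource x₁)
    (h0 : v ∈ slit n M) (ξ : TangentSpace (𝓡 n).tangent v) :
    fderiv ℝ (natTransition n x₀ x₁) (natChart x₀ v) (natDeriv x₀ v ξ) = natDeriv x₁ v ξ := by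
  rw [fderiv_natTransition hv₀ hv₁ h0, coordFrame_natDeriv hv₀ h0]

lemma localForm_eq_natTransition
    (α : ∀ v : TangentBundle (𝓡 n) M, TangentSpace (𝓡 n).tangent v →L[ℝ] ℝ)
    (hz : z ∈ transDomain x₀ x₁) :
    localForm α x₀ z = (localForm α x₁ (natTransition n x₀ x₁ z)).comp
      (fderiv ℝ (natTransition n x₀ x₁) z) := by
  refine ContinuousLinearMap.ext fun u => ?_
  have hv := natChart_symm_mem_natSource (n := n) hz.1
  have h0 := natChart_symm_mem_slit (n := n) hz.1
  have h1 := localForm_natChart α hv u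
  have h2 := fderiv_natTransition hv hz.2 h0 u
  rw [natChart_natChart_symm hz.1] at h1 h2
  rw [h1, ContinuousLinearMap.comp_apply, h2, natTransition, localForm_natDeriv α hz.2 h0]

/-- The contraction of the exterior derivative can be computed in any natural chart. -/
lemma contractExtDeriv_eq (hv : v ∈ natSource x₀) (h0 : v ∈ slit n M)
    (hα : DifferentiableAt ℝ (localForm α v.proj) (natChart v.proj v))
    (ξ η : TangentSpace (𝓡 n).tangent v) :
    contractExtDeriv α v ξ η =
      fderiv ℝ (localForm α x₀) (natChart x₀ v) (natDeriv x₀ v ξ) (natDeriv x₀ v η)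
      - fderiv ℝ (localForm α x₀) (natChart x₀ v) (natDeriv x₀ v η) (natDeriv x₀ v ξ) := by
  have hv₁ := mem_natSource_proj v
  have hz := natChart_mem_transDomain hv hv₁ h0
  set z := natChart x₀ v with hzdef
  have hφ := contDiffOn_natTransition (n := n) (x₀ := x₀) (x₁ := v.proj)
  have hd := differentiableAt_of_contDiffOn isOpen_transDomain hφ hz
  have hd1 := differentiableAt_of_contDiffOn isOpen_transDomain
    (contDiffOn_fderiv isOpen_transDomain hφ) hz
  have hz1 : natTransition n x₀ v.proj z = natChart v.proj v := natTransition_natChart hv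
  have hα' : DifferentiableAt ℝ (localForm α v.proj) (natTransition n x₀ v.proj z) := by
    rwa [hz1]
  have h1 : fderiv ℝ (localForm α x₀) z = fderiv ℝ (fun z =>
      (localForm α v.proj (natTransition n x₀ v.proj z)).comp
        (fderiv ℝ (natTransition n x₀ v.proj) z)) z := by
    apply Filter.EventuallyEq.fderiv_eq
    filter_upwards [isOpen_transDomain.mem_nhds hz] with w hw
      using localForm_eq_natTransition α hw
  have hcomp : HasFDerivAt (fun z => localForm α v.proj (natTransition n x₀ v.proj z))
      ((fderiv ℝ (localForm α v.proj) (natTransition n x₀ v.proj z)).comp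
        (fderiv ℝ (natTransition n x₀ v.proj) z)) z :=
    hα'.hasFDerivAt.comp z hd.hasFDerivAt
  have h2 : ∀ u w, fderiv ℝ (localForm α x₀) z u w =
      fderiv ℝ (localForm α v.proj) (natChart v.proj v)
        (fderiv ℝ (natTransition n x₀ v.proj) z u) (fderiv ℝ (natTransition n x₀ v.proj) z w)
      + localForm α v.proj (natChart v.proj v)
        (fderiv ℝ (fderiv ℝ (natTransition n x₀ v.proj)) z u w) := by
    intro u w
    rw [h1, (hcomp.clm_comp hd1.hasFDerivAt).fderiv, hz1]
    simp [add_comm]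
  -- The pulled-back form contributes second derivatives of the transition map; being symmetric,
  -- they disappear on antisymmetrizing.
  have h3 := fderiv_fderiv_symm isOpen_transDomain hφ hz (natDeriv x₀ v ξ) (natDeriv x₀ v η)
  rw [h2, h2, h3, hzdef, fderiv_natTransition_natDeriv hv hv₁ h0,
    fderiv_natTransition_natDeriv hv hv₁ h0, add_sub_add_right_eq_sub]
  rfl

lemma fderiv_localForm_vertDiff (hf : SmoothFun f) (hz : z ∈ natDomain x₀)
    (u w : Coord n × Coord n) :
    fderiv ℝ (localForm (vertDiff f) x₀) z u w =
      fderiv ℝ (fderiv ℝ (localFun f x₀)) z u (0, w.1) := by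
  have hd := differentiableAt_of_contDiffOn isOpen_natDomain
    (contDiffOn_fderiv isOpen_natDomain (hf.contDiffOn x₀)) hz
  have h1 : fderiv ℝ (localForm (vertDiff f) x₀) z = fderiv ℝ (fun z =>
      (fderiv ℝ (localFun f x₀) z).comp
      (verticalShift n)) z := by
    apply Filter.EventuallyEq.fderiv_eq
    filter_upwards [isOpen_natDomain.mem_nhds hz] with w hw using localForm_vertDiff hf hw
  rw [h1, (hd.hasFDerivAt.clm_comp (hasFDerivAt_const (verticalShift n) z)).fderiv]
  simp [verticalShift_apply]

lemma differentiableAt_localForm_vertDiff (hf : SmoothFun f) (hz : z ∈ natDomain x₀) :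
    DifferentiableAt ℝ (localForm (vertDiff f) x₀) z := by
  have hd := differentiableAt_of_contDiffOn isOpen_natDomain
    (contDiffOn_fderiv isOpen_natDomain (hf.contDiffOn x₀)) hz
  refine (hd.clm_comp (differentiableAt_const (verticalShift n))).congr_of_eventuallyEq ?_
  filter_upwards [isOpen_natDomain.mem_nhds hz] with w hw using localForm_vertDiff hf hw

/-- The contraction `i_ξ dd_J f` in coordinates. -/
lemma contractExtDeriv_vertDiff (hf : SmoothFun f) (hv : v ∈ natSource x₀) (h0 : v ∈ slit n M)
    (ξ η : TangentSpace (𝓡 n).tangent v) :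
    contractExtDeriv (vertDiff f) v ξ η =
      fderiv ℝ (fderiv ℝ (localFun f x₀)) (natChart x₀ v) (natDeriv x₀ v ξ)
        (0, (natDeriv x₀ v η).1)
      - fderiv ℝ (fderiv ℝ (localFun f x₀)) (natChart x₀ v) (natDeriv x₀ v η)
        (0, (natDeriv x₀ v ξ).1) := by
  have hz := natChart_mem_natDomain hv h0
  rw [contractExtDeriv_eq hv h0 (differentiableAt_localForm_vertDiff hf
    (natChart_mem_natDomain (mem_natSource_proj v) h0)), fderiv_localForm_vertDiff hf hz,
    fderiv_localForm_vertDiff hf hz]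

/-- Homogeneity in coordinates. -/
lemma Homogeneous.fderiv_eq {p : ℝ} (hf : SmoothFun f) (hh : Homogeneous p f)
    (hz : z ∈ natDomain x₀) : fderiv ℝ (localFun f x₀) z (0, z.2) = p * localFun f x₀ z := by
  have hv := natChart_symm_mem_natSource (n := n) hz
  have h0 := natChart_symm_mem_slit (n := n) hz
  have h1 := hh _ h0
  rwa [act, hf.diff_eq hv h0, natDeriv_liouville hv, natChart_natChart_symm hz] at h1

lemma homogeneous_of_fderiv_eq {p : ℝ} (hf : SmoothFun f)
    (h : ∀ x₀ : M, ∀ z ∈ natDomain x₀,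
      fderiv ℝ (localFun f x₀) z (0, z.2) = p * localFun f x₀ z) : Homogeneous p f := by
  intro v h0
  have hv := mem_natSource_proj v
  rw [act, hf.diff_eq hv h0, natDeriv_liouville hv, h _ _ (natChart_mem_natDomain hv h0),
    localFun_natChart f hv]

end Representations

/-! ### Finsler metrics in natural charts and independence of the chart. -/

section Finsler

variable {n : ℕ} {M : Type*} [TopologicalSpace M] [ChartedSpace (Coord n) M]
  [IsManifold (𝓡 n) ∞ M] {x₀ x₁ : M} {v : TangentBundle (𝓡 n) M} {z : Coord n × Coord n}
  {f : TangentBundle (𝓡 n) M → ℝ} {F : TangentBundle (𝓡 n) M → ℝ}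
  {G : ∀ v : TangentBundle (𝓡 n) M, TangentSpace (𝓡 n).tangent v}

/-- The energy `½ F²`. -/
def energy (F : TangentBundle (𝓡 n) M → ℝ) (w : TangentBundle (𝓡 n) M) : ℝ :=
  (1 / 2 : ℝ) * F w ^ 2

lemma IsFinsler.smooth_energy (hF : IsFinsler F) : SmoothFun (energy F) :=
  SmoothFun.of_contDiffOn fun x₀ =>
    contDiffOn_const.mul ((hF.smooth.contDiffOn x₀).pow 2)

lemma natChart_symm_smul (hz : z ∈ natDomain (n := n) x₀) (c : ℝ) :
    (natChart x₀).symm (z.1, c • z.2) =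
      (⟨((natChart x₀).symm z).proj, c • ((natChart x₀).symm z).2⟩ : TangentBundle (𝓡 n) M) := by
  have hv := natChart_symm_mem_natSource (n := n) hz
  have h1 := natChart_apply_mk hv (c • ((natChart x₀).symm z).2)
  have h2 := natChart_apply hv
  rw [natChart_natChart_symm hz] at h2
  rw [map_smul] at h1
  have h3 : (z.1, c • z.2) = natChart x₀ (⟨((natChart x₀).symm z).proj,
      c • ((natChart x₀).symm z).2⟩ : TangentBundle (𝓡 n) M) := by
    rw [h1, congrArg Prod.fst h2, congrArg Prod.snd h2]
  rw [h3, natChart_symm_natChart]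
  exact hv

/-- The energy is 2-homogeneous. -/
lemma IsFinsler.fderiv_energy_vert (hF : IsFinsler F) (hz : z ∈ natDomain x₀) :
    fderiv ℝ (localFun (energy F) x₀) z (0, z.2) = 2 * localFun (energy F) x₀ z := by
  have hd := differentiableAt_of_contDiffOn isOpen_natDomain
    (hF.smooth_energy.contDiffOn x₀) hz
  have h1 : HasDerivAt (fun c : ℝ => (z.1, c • z.2)) (0, z.2) 1 := by
    simpa using (hasDerivAt_const (1 : ℝ) z.1).prodMk ((hasDerivAt_id (1 : ℝ)).smul_const z.2)
  have hz1 : (z.1, (1 : ℝ) • z.2) = z := by simp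
  have h2 : HasDerivAt (fun c : ℝ => localFun (energy F) x₀ (z.1, c • z.2))
      (fderiv ℝ (localFun (energy F) x₀) z (0, z.2)) 1 := by
    have hd1 : HasFDerivAt (localFun (energy F) x₀) (fderiv ℝ (localFun (energy F) x₀) z)
        (z.1, (1 : ℝ) • z.2) := by
      rw [hz1]
      exact hd.hasFDerivAt
    exact hd1.comp_hasDerivAt 1 h1
  have h3 : HasDerivAt (fun c : ℝ => localFun (energy F) x₀ z * c ^ 2)
      (localFun (energy F) x₀ z * 2) 1 := by
    simpa using (hasDerivAt_pow 2 (1 : ℝ)).const_mul (localFun (energy F) x₀ z)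
  have h4 : (fun c : ℝ => localFun (energy F) x₀ (z.1, c • z.2)) =ᶠ[nhds 1]
      fun c : ℝ => localFun (energy F) x₀ z * c ^ 2 := by
    -- Scaling is assumed only for `c > 0`, which is enough to differentiate `c ↦ L(x, cy) = c² L(x,
    -- y)` at `c = 1`.
    filter_upwards [lt_mem_nhds (zero_lt_one (α := ℝ))] with c hc
    rw [localFun, natChart_symm_smul hz, energy, hF.homogeneous _ _ c hc, localFun, energy]
    ring
  rw [(h2.congr_of_eventuallyEq h4.symm).unique h3]
  ring

lemma IsFinsler.metricMatrix_eq (hF : IsFinsler F) (hv : v ∈ natSource x₀) (h0 : v ∈ slit n M) :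
    metricMatrix F x₀ v = vertHessian (localFun (energy F) x₀) (natChart x₀ v) := by
  have hz := natChart_mem_natDomain hv h0
  have hs := hF.smooth_energy.contDiffOn x₀
  have hd := differentiableAt_of_contDiffOn isOpen_natDomain (contDiffOn_fderiv isOpen_natDomain hs)
    hz
  ext i j
  have h1 : (fun z => fderiv ℝ (fun z' => F ((natChart x₀).symm z') ^ 2) z (0, stdVec j))
      =ᶠ[nhds (natChart x₀ v)]
      fun z => (2 : ℝ) * fderiv ℝ (localFun (energy F) x₀) z (0, stdVec j) := by
    filter_upwards [isOpen_natDomain.mem_nhds hz] with w hw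
    have h2 : (fun z' => F ((natChart x₀).symm z') ^ 2) =
        fun z' => (2 : ℝ) * localFun (energy F) x₀ z' := by
      ext z'
      simp only [localFun, energy]
      ring
    rw [h2, fderiv_const_mul (differentiableAt_of_contDiffOn isOpen_natDomain hs hw)]
    rfl
  rw [metricMatrix, h1.fderiv_eq, fderiv_const_mul (hd.clm_apply (differentiableAt_const _)),
    smul_apply, fderiv_clm_apply_const hd, vertHessian, Matrix.of_apply, smul_eq_mul]
  ring

lemma IsFinsler.det_ne_zero (hF : IsFinsler F) (hz : z ∈ natDomain x₀) :
    (vertHessian (localFun (energy F) x₀) z).det ≠ 0 := by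
  have hv := natChart_symm_mem_natSource (n := n) hz
  have h0 := natChart_symm_mem_slit (n := n) hz
  have h1 := hF.rank_eq x₀ _ h0 hv
  rw [hF.metricMatrix_eq hv h0, natChart_natChart_symm hz] at h1
  have h2 : LinearMap.range (vertHessian (localFun (energy F) x₀) z).mulVecLin = ⊤ :=
    Submodule.eq_top_of_finrank_eq (h1.trans (by simp))
  exact ((Matrix.isUnit_iff_isUnit_det _).1 (Matrix.mulVec_surjective_iff_isUnit.1
    (LinearMap.range_eq_top.1 h2))).ne_zero

/-- A geodesic spray in natural coordinates. -/
lemma IsGeodesicSpray.isLocalSpray (hF : IsFinsler F) (hG : IsGeodesicSpray F G) (x₀ : M) :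
    IsLocalSpray (natDomain x₀) (localFun (energy F) x₀) (localField G x₀) where
  isOpen := isOpen_natDomain
  smooth_lagrangian := hF.smooth_energy.contDiffOn x₀
  smooth_field := hG.smooth.contDiffOn x₀
  euler _ hz := hF.fderiv_energy_vert hz
  nondegenerate _ hz := nondegenerate_of_det_ne_zero (hF.det_ne_zero hz)
  geodesic z hz u := by
    have hv := natChart_symm_mem_natSource (n := n) hz
    have h0 := natChart_symm_mem_slit (n := n) hz
    have h1 := DFunLike.congr_fun (hG.eq _ h0) (coordFrame x₀ _ u)
    have h2 := contractExtDeriv_vertDiff hF.smooth_energy hv h0 (G _) (coordFrame x₀ _ u)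
    have h3 := hF.smooth_energy.diff_eq hv h0 (coordFrame x₀ _ u)
    rw [natDeriv_coordFrame hv h0, natChart_natChart_symm hz] at h2 h3
    have h4 := h2.symm.trans h1
    rw [neg_apply] at h4
    rw [← h3]
    exact h4

/-- A projective deformation in natural coordinates. -/
lemma IsProjectiveDeformation.localField_eq
    {G' : ∀ v : TangentBundle (𝓡 n) M, TangentSpace (𝓡 n).tangent v}
    {P : TangentBundle (𝓡 n) M → ℝ} (hP : IsProjectiveDeformation G G' P)
    (hz : z ∈ natDomain x₀) :
    localField G' x₀ z = localField G x₀ z - (2 * localFun P x₀ z) • ((0 : Coord n), z.2) := by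
  have hv := natChart_symm_mem_natSource (n := n) hz
  rw [localField, hP.eq _ (natChart_symm_mem_slit hz), map_sub, map_smul, natDeriv_liouville hv,
    natChart_natChart_symm hz]
  rfl

/-! ### Change of natural chart -/

/-- The linear part of the transition between two natural charts along the fibre over `x`. -/
def fibreTransition (x₀ x₁ x : M) : Coord n →L[ℝ] Coord n :=
  (fibreMap x₁ x).comp (fibreMap x₀ x).inverse

lemma natDeriv_coordFrame_vert (hv₀ : v ∈ natSource x₀) (hv₁ : v ∈ natSource x₁)
    (h0 : v ∈ slit n M) (d : Coord n) :
    natDeriv x₁ v (coordFrame x₀ v (0, d)) = (0, fibreTransition x₀ x₁ v.proj d) := by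
  have h1 := natDeriv_verticalLift hv₀ ((fibreMap x₀ v.proj).inverse d)
  rw [(fibreMap_isInvertible hv₀).self_apply_inverse] at h1
  rw [← h1, coordFrame_natDeriv hv₀ h0, natDeriv_verticalLift hv₁]
  rfl

/-- With the preceding lemma, the Jacobian of a change of natural charts is block triangular and
carries the same diagonal block twice. -/
lemma natDeriv_coordFrame_fst (hv₀ : v ∈ natSource x₀) (hv₁ : v ∈ natSource x₁)
    (h0 : v ∈ slit n M) (u : Coord n × Coord n) :
    (natDeriv x₁ v (coordFrame x₀ v u)).1 = fibreTransition x₀ x₁ v.proj u.1 := by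
  have h1 := fibreMap_mfderiv_proj hv₀ (coordFrame x₀ v u)
  rw [natDeriv_coordFrame hv₀ h0] at h1
  rw [← fibreMap_mfderiv_proj hv₁, fibreTransition, ← h1, ContinuousLinearMap.comp_apply,
    (fibreMap_isInvertible hv₀).inverse_apply_self]

/-- The matrix of a linear map, acting on rows. -/
def rowMatrix (A : Coord n →L[ℝ] Coord n) : Matrix (Fin n) (Fin n) ℝ :=
  Matrix.of fun i k => A (stdVec i) k

lemma fderiv_localFun_vert (hf : SmoothFun f) (hz : z ∈ transDomain x₀ x₁) (d : Coord n) :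
    fderiv ℝ (localFun f x₀) z (0, d) =
      fderiv ℝ (localFun f x₁) (natTransition n x₀ x₁ z)
        (0, fibreTransition x₀ x₁ ((chartAt (Coord n) x₀).symm z.1) d) := by
  have hv := natChart_symm_mem_natSource (n := n) hz.1
  have h0 := natChart_symm_mem_slit (n := n) hz.1
  have h1 := hf.diff_eq hv h0 (coordFrame x₀ _ (0, d))
  have h2 := hf.diff_eq hz.2 h0 (coordFrame x₀ _ (0, d))
  rw [natDeriv_coordFrame hv h0, natChart_natChart_symm hz.1] at h1
  rw [natDeriv_coordFrame_vert hv hz.2 h0] at h2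
  exact h1.symm.trans h2

lemma fderiv_fderiv_localFun_vert (hf : SmoothFun f) (hz : z ∈ transDomain x₀ x₁)
    (c d : Coord n) :
    fderiv ℝ (fderiv ℝ (localFun f x₀)) z (0, c) (0, d) =
      fderiv ℝ (fderiv ℝ (localFun f x₁)) (natTransition n x₀ x₁ z)
        (0, fibreTransition x₀ x₁ ((chartAt (Coord n) x₀).symm z.1) c)
        (0, fibreTransition x₀ x₁ ((chartAt (Coord n) x₀).symm z.1) d) := by
  set A := fibreTransition (n := n) x₀ x₁ ((chartAt (Coord n) x₀).symm z.1) with hA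
  have hv := natChart_symm_mem_natSource (n := n) hz.1
  have h0 := natChart_symm_mem_slit (n := n) hz.1
  have hφ := differentiableAt_of_contDiffOn isOpen_transDomain
    (contDiffOn_natTransition (x₀ := x₀) (x₁ := x₁)) hz
  have hφz : natTransition n x₀ x₁ z ∈ natDomain x₁ := natChart_mem_natDomain hz.2 h0
  have hd0 := differentiableAt_of_contDiffOn isOpen_natDomain
    (contDiffOn_fderiv isOpen_natDomain (hf.contDiffOn x₀)) hz.1
  have hd1 := differentiableAt_of_contDiffOn isOpen_natDomain
    (contDiffOn_fderiv isOpen_natDomain (hf.contDiffOn x₁)) hφz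
  have hcomp := hd1.hasFDerivAt.comp z hφ.hasFDerivAt
  have hg : HasFDerivAt (fun w => fderiv ℝ (localFun f x₁) (natTransition n x₀ x₁ w) (0, A d))
      _ z := hcomp.clm_apply (hasFDerivAt_const ((0 : Coord n), A d) z)
  -- The fibre transition depends on the base point, so the first-order formula holds with the fixed
  -- `A` only along the vertical line through `z`. A line derivative is therefore compared, and no
  -- derivative of `A` appears.
  have h1 : lineDeriv ℝ (fun w => fderiv ℝ (localFun f x₀) w (0, d)) z (0, c) =
      lineDeriv ℝ (fun w => fderiv ℝ (localFun f x₁) (natTransition n x₀ x₁ w) (0, A d)) z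
        (0, c) := by
    apply Filter.EventuallyEq.deriv_eq
    have hcont : ContinuousAt (fun t : ℝ => z + t • ((0 : Coord n), c)) 0 := by fun_prop
    have hmem : transDomain x₀ x₁ ∈ nhds (z + (0 : ℝ) • ((0 : Coord n), c)) := by
      rw [zero_smul, add_zero]
      exact isOpen_transDomain.mem_nhds hz
    filter_upwards [hcont.preimage_mem_nhds hmem] with t ht
    have h3 : (z + t • ((0 : Coord n), c)).1 = z.1 := by simp
    rw [fderiv_localFun_vert hf ht, h3]
  rw [(hd0.clm_apply (differentiableAt_const _)).lineDeriv_eq_fderiv,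
    hg.differentiableAt.lineDeriv_eq_fderiv, fderiv_clm_apply_const hd0, hg.fderiv] at h1
  have h4 := fderiv_natTransition hv hz.2 h0 (0, c)
  rw [natChart_natChart_symm hz.1, natDeriv_coordFrame_vert hv hz.2 h0] at h4
  rw [h1]
  simp [h4]
  rfl

/-- The vertical Hessian is a bilinear form on the fibre; its determinant acquires the same squared
factor as the volume coefficient. -/
lemma det_vertHessian_localFun (hf : SmoothFun f) (hz : z ∈ transDomain x₀ x₁) :
    (vertHessian (localFun f x₀) z).det =
      (rowMatrix (fibreTransition (n := n) x₀ x₁ ((chartAt (Coord n) x₀).symm z.1))).det ^ 2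
        * (vertHessian (localFun f x₁) (natTransition n x₀ x₁ z)).det := by
  set A := fibreTransition (n := n) x₀ x₁ ((chartAt (Coord n) x₀).symm z.1) with hA
  have h1 : vertHessian (localFun f x₀) z = rowMatrix A *
      vertHessian (localFun f x₁) (natTransition n x₀ x₁ z) * (rowMatrix A).transpose := by
    ext i j
    rw [vertHessian, Matrix.of_apply, fderiv_fderiv_localFun_vert hf hz, ← hA,
      clm_vert_eq_sum (fderiv ℝ (fderiv ℝ (localFun f x₁)) (natTransition n x₀ x₁ z))]
    simp only [sum_apply, smul_apply, Matrix.mul_apply, Matrix.transpose_apply, Finset.sum_mul]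
    rw [Finset.sum_comm]
    refine Finset.sum_congr rfl fun k _ => ?_
    rw [clm_vert_eq_sum, Finset.smul_sum]
    refine Finset.sum_congr rfl fun l _ => ?_
    simp only [rowMatrix, vertHessian, Matrix.of_apply, smul_eq_mul]
    ring
  rw [h1, Matrix.det_mul, Matrix.det_mul, Matrix.det_transpose]
  ring

/-! ### Volume forms and the distortion on the manifold. -/

section Volume

variable {Ω : ∀ v : TangentBundle (𝓡 n) M,
  (TangentSpace (𝓡 n).tangent v) [⋀^Fin n ⊕ Fin n]→ₗ[ℝ] ℝ}

lemma volCoeff_eq (hv₀ : v ∈ natSource x₀) (hv₁ : v ∈ natSource x₁) (h0 : v ∈ slit n M) :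
    volCoeff Ω x₀ v = (rowMatrix (fibreTransition (n := n) x₀ x₁ v.proj)).det ^ 2
      * volCoeff Ω x₁ v := by
  let b := (EuclideanSpace.basisFun (Fin n) ℝ).toBasis.prod
    (EuclideanSpace.basisFun (Fin n) ℝ).toBasis
  let N : Coord n × Coord n → Coord n × Coord n := fun u => natDeriv x₁ v (coordFrame x₀ v u)
  let T : (Coord n × Coord n) →ₗ[ℝ] TangentSpace (𝓡 n).tangent v := (coordFrame x₁ v).toLinearMap
  let Θ := (Ω v).compLinearMap T
  have hb : ⇑b = Sum.elim (fun i => (stdVec i, 0)) (fun i => (0, stdVec i)) := by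
    ext1 i
    rcases i with i | i <;> simp [b, stdVec]
  have h1 : volCoeff Ω x₁ v = Θ b := by
    rw [hb]
    simp only [volCoeff, Θ, AlternatingMap.compLinearMap_apply]
    congr 1
    ext1 i
    rcases i with i | i <;> rfl
  have h2 : volCoeff Ω x₀ v = Θ (N ∘ b) := by
    rw [hb]
    simp only [volCoeff, Θ, AlternatingMap.compLinearMap_apply]
    congr 1
    ext1 i
    rcases i with i | i <;> exact (coordFrame_natDeriv hv₁ h0 _).symm
  -- The lower left block is left unspecified, as it does not affect the determinant.
  have h3 : b.toMatrix (N ∘ b) = Matrix.fromBlocks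
      (rowMatrix (fibreTransition (n := n) x₀ x₁ v.proj)).transpose 0
      (Matrix.of fun k i => (N (stdVec i, 0)).2 k)
      (rowMatrix (fibreTransition (n := n) x₀ x₁ v.proj)).transpose := by
    ext k i
    rw [Module.Basis.toMatrix_apply, Function.comp_apply, hb]
    rcases k with k | k <;> rcases i with i | i
    · simp [b, N, natDeriv_coordFrame_fst hv₀ hv₁ h0, rowMatrix]
    · simp [b, N, natDeriv_coordFrame_fst hv₀ hv₁ h0, rowMatrix]
    · simp [b, N]
    · simp [b, N, natDeriv_coordFrame_vert hv₀ hv₁ h0, rowMatrix]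
  rw [h1, h2, AlternatingMap.eq_smul_basis_det b Θ]
  simp only [AlternatingMap.smul_apply, Module.Basis.det_apply, h3, Matrix.det_fromBlocks_zero₁₂,
    Matrix.det_transpose, Module.Basis.toMatrix_self, Matrix.det_one, smul_eq_mul]
  ring

/-- The common nonzero factor cancels in `det g / σ`. This replaces the chart at the moving point
`π(v)` by a fixed one, in which the distortion can be differentiated. -/
lemma IsFinsler.distortion_eq (hF : IsFinsler F) (hv : v ∈ natSource x₀) (h0 : v ∈ slit n M)
    {σ : Coord n → ℝ} (hσ : volCoeff Ω x₀ v = σ (chartAt (Coord n) x₀ v.proj)) :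
    distortion F Ω v = localDistortion (localFun (energy F) x₀) σ (natChart x₀ v) := by
  have hv₁ := mem_natSource_proj v
  have hz := natChart_mem_transDomain hv₁ hv h0
  have h1 := det_vertHessian_localFun hF.smooth_energy hz
  have h2 := hF.det_ne_zero hz.1
  have h3 : (chartAt (Coord n) v.proj).symm (natChart v.proj v).1 = v.proj := by
    rw [natChart_apply hv₁]
    exact (chartAt (Coord n) v.proj).left_inv hv₁
  rw [natTransition_natChart hv₁, h3] at h1
  rw [h1] at h2
  rw [distortion, hF.metricMatrix_eq hv₁ h0, h1, volCoeff_eq hv₁ hv h0,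
    mul_div_mul_left _ _ (left_ne_zero_of_mul h2), localDistortion, hσ, natChart_apply hv]

lemma IsFinsler.localFun_distortion (hF : IsFinsler F) {σ : Coord n → ℝ}
    (hσ : ∀ v ∈ slit n M, v.proj ∈ (chartAt (Coord n) x₀).source →
      volCoeff Ω x₀ v = σ (chartAt (Coord n) x₀ v.proj)) (hz : z ∈ natDomain x₀) :
    localFun (distortion F Ω) x₀ z = localDistortion (localFun (energy F) x₀) σ z := by
  have hv := natChart_symm_mem_natSource (n := n) hz
  have h0 := natChart_symm_mem_slit (n := n) hz
  rw [localFun, hF.distortion_eq hv h0 (hσ _ h0 hv), natChart_natChart_symm hz]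

lemma IsFinsler.smooth_distortion (hF : IsFinsler F) (hΩ : IsVolumeForm Ω) :
    SmoothFun (distortion F Ω) := by
  refine SmoothFun.of_contDiffOn fun x₀ => ?_
  obtain ⟨σ, hσs, hσp, hσ⟩ := hΩ x₀
  exact (contDiffOn_localDistortion isOpen_natDomain (hF.smooth_energy.contDiffOn x₀)
    (fun z hz => hF.det_ne_zero hz) (fun z hz => hz.1) hσs hσp).congr
      fun z hz => hF.localFun_distortion hσ hz

end Volume

end Finsler

/-! ### Projectively related sprays. -/

section Projective

variable {n : ℕ} {M : Type*} [TopologicalSpace M] [ChartedSpace (Coord n) M]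
  [IsManifold (𝓡 n) ∞ M] {x₀ : M} {v : TangentBundle (𝓡 n) M} {z : Coord n × Coord n}
  {f g k : TangentBundle (𝓡 n) M → ℝ} {F F' P : TangentBundle (𝓡 n) M → ℝ}
  {G G' : ∀ v : TangentBundle (𝓡 n) M, TangentSpace (𝓡 n).tangent v}
  {Ω : ∀ v : TangentBundle (𝓡 n) M,
    (TangentSpace (𝓡 n).tangent v) [⋀^Fin n ⊕ Fin n]→ₗ[ℝ] ℝ}

/-- A semispray: a vector field `G` on `T₀M` with `JG = 𝒞`, expressed in natural coordinates. -/
def IsSemispray (G : ∀ v : TangentBundle (𝓡 n) M, TangentSpace (𝓡 n).tangent v) : Prop :=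
  ∀ x₀ : M, ∀ z ∈ natDomain x₀, (localField G x₀ z).1 = z.2

lemma IsGeodesicSpray.isSemispray (hF : IsFinsler F) (hG : IsGeodesicSpray F G) :
    IsSemispray G :=
  fun x₀ _ hz => (hG.isLocalSpray hF x₀).fst_eq hz

lemma SmoothFun.differentiableAt (hf : SmoothFun f) (hz : z ∈ natDomain x₀) :
    DifferentiableAt ℝ (localFun f x₀) z :=
  differentiableAt_of_contDiffOn isOpen_natDomain (hf.contDiffOn x₀) hz

lemma SmoothFun.differentiableAt_fderiv (hf : SmoothFun f) (hz : z ∈ natDomain x₀) :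
    DifferentiableAt ℝ (fderiv ℝ (localFun f x₀)) z :=
  differentiableAt_of_contDiffOn isOpen_natDomain
    (contDiffOn_fderiv isOpen_natDomain (hf.contDiffOn x₀)) hz

/-- The Euler-Lagrange form `{G(∂f/∂yⁱ) - ∂f/∂xⁱ} dxⁱ` of a semispray in coordinates. -/
lemma eulerLagrange_apply (hf : SmoothFun f) (hG : IsSemispray G) (hv : v ∈ natSource x₀)
    (h0 : v ∈ slit n M) (η : TangentSpace (𝓡 n).tangent v) :
    eulerLagrange G f v η =
      fderiv ℝ (fderiv ℝ (localFun f x₀)) (natChart x₀ v) (localField G x₀ (natChart x₀ v))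
        (0, (natDeriv x₀ v η).1)
      - fderiv ℝ (localFun f x₀) (natChart x₀ v) ((natDeriv x₀ v η).1, 0) := by
  have hz := natChart_mem_natDomain hv h0
  have hd1 := hf.differentiableAt_fderiv hz
  have h1 : localFun (fun w => vertDiff f w (G w)) x₀ =ᶠ[nhds (natChart x₀ v)]
      fun w => fderiv ℝ (localFun f x₀) w (0, w.2) := by
    filter_upwards [isOpen_natDomain.mem_nhds hz] with w hw
    have hv' := natChart_symm_mem_natSource (n := n) hw
    have h0' := natChart_symm_mem_slit (n := n) hw
    rw [← hG x₀ w hw, localFun, vertDiff, ContinuousLinearMap.comp_apply, hf.diff_eq hv' h0',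
      natDeriv_tangentEndo hv', natChart_natChart_symm hw]
    rfl
  have h2 : diff (fun w => vertDiff f w (G w)) v η =
      fderiv ℝ (fderiv ℝ (localFun f x₀)) (natChart x₀ v) (natDeriv x₀ v η)
        (0, (natChart x₀ v).2)
      + fderiv ℝ (localFun f x₀) (natChart x₀ v) (0, (natDeriv x₀ v η).2) := by
    rw [diff_eq_of_differentiableAt hv
      ((hd1.clm_apply differentiableAt_vert).congr_of_eventuallyEq h1), h1.fderiv_eq,
      fderiv_clm_apply hd1 differentiableAt_vert]
    simp only [add_apply, ContinuousLinearMap.comp_apply, ContinuousLinearMap.flip_apply,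
      fderiv_vert, add_comm]
  have h3 : natDeriv x₀ v η = ((natDeriv x₀ v η).1, 0) + (0, (natDeriv x₀ v η).2) := by simp
  have h4 : fderiv ℝ (localFun f x₀) (natChart x₀ v) (natDeriv x₀ v η) =
      fderiv ℝ (localFun f x₀) (natChart x₀ v) ((natDeriv x₀ v η).1, 0)
      + fderiv ℝ (localFun f x₀) (natChart x₀ v) (0, (natDeriv x₀ v η).2) := by
    rw [← map_add, ← h3]
  have h5 := localField_natChart G hv
  have h6 := hG x₀ _ hz
  -- Since `JG = 𝒞`, the terms `D²f(η)(0, y)` from `i_G dd_J f` and from `d(d_J f(G))` cancel, and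
  -- the vertical part of `df` cancels too, leaving only `dxⁱ` components.
  rw [eulerLagrange, lieDerivForm, sub_apply, add_apply, h2, hf.diff_eq hv h0,
    contractExtDeriv_vertDiff hf hv h0, h4, ← h5, h6]
  ring

/-- Linearity in the function; an identity on `T₀M` alone suffices because the slit chart domains
are open. -/
lemma eulerLagrange_of_eq_add (hk : SmoothFun k) (hf : SmoothFun f) (hg : SmoothFun g)
    (hG : IsSemispray G) {c : ℝ} (h : ∀ v ∈ slit n M, k v = f v + c * g v)
    (h0 : v ∈ slit n M) :
    eulerLagrange G k v = eulerLagrange G f v + c • eulerLagrange G g v := by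
  have hv := mem_natSource_proj v
  have hz := natChart_mem_natDomain hv h0
  have h1 : ∀ w ∈ natDomain v.proj, fderiv ℝ (localFun k v.proj) w =
      fderiv ℝ (localFun f v.proj) w + c • fderiv ℝ (localFun g v.proj) w := by
    intro w hw
    have h2 : localFun k v.proj =ᶠ[nhds w]
        fun w => localFun f v.proj w + c * localFun g v.proj w := by
      filter_upwards [isOpen_natDomain.mem_nhds hw] with u hu
        using h _ (natChart_symm_mem_slit hu)
    rw [h2.fderiv_eq, fderiv_fun_add (hf.differentiableAt hw)
      ((hg.differentiableAt hw).const_mul c), fderiv_const_mul (hg.differentiableAt hw)]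
  have h3 : fderiv ℝ (fderiv ℝ (localFun k v.proj)) (natChart v.proj v) =
      fderiv ℝ (fderiv ℝ (localFun f v.proj)) (natChart v.proj v)
      + c • fderiv ℝ (fderiv ℝ (localFun g v.proj)) (natChart v.proj v) := by
    have h2 : fderiv ℝ (localFun k v.proj) =ᶠ[nhds (natChart v.proj v)]
        fun w => fderiv ℝ (localFun f v.proj) w + c • fderiv ℝ (localFun g v.proj) w := by
      filter_upwards [isOpen_natDomain.mem_nhds hz] with u hu using h1 u hu
    rw [h2.fderiv_eq, fderiv_fun_add (hf.differentiableAt_fderiv hz)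
      ((hg.differentiableAt_fderiv hz).fun_const_smul c),
      fderiv_fun_const_smul (hg.differentiableAt_fderiv hz)]
  refine ContinuousLinearMap.ext fun η => ?_
  rw [add_apply, smul_apply, eulerLagrange_apply hk hG hv h0, eulerLagrange_apply hf hG hv h0,
    eulerLagrange_apply hg hG hv h0, h1 _ hz, h3]
  simp only [add_apply, smul_apply, smul_eq_mul]
  ring

lemma IsProjectiveDeformation.isSemispray (hP : IsProjectiveDeformation G G' P)
    (hG : IsSemispray G) : IsSemispray G' := by
  intro x₀ z hz
  rw [hP.localField_eq hz]
  simp [hG x₀ z hz]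

/-- The Euler-Lagrange form of a 1-homogeneous function is a projective invariant. -/
lemma IsProjectiveDeformation.eulerLagrange_eq (hP : IsProjectiveDeformation G G' P)
    (hG : IsSemispray G) (hf : SmoothFun f) (hh : Homogeneous 1 f) (h0 : v ∈ slit n M) :
    eulerLagrange G' f v = eulerLagrange G f v := by
  have hv := mem_natSource_proj v
  have hz := natChart_mem_natDomain hv h0
  refine ContinuousLinearMap.ext fun η => ?_
  rw [eulerLagrange_apply hf (hP.isSemispray hG) hv h0, eulerLagrange_apply hf hG hv h0,
    hP.localField_eq hz]
  -- The two forms differ by `-2P 𝒞(∂f/∂yⁱ) dxⁱ`, and the Euler relation of degree 1 differentiates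
  -- to `𝒞(∂f/∂yⁱ) = 0`.
  have h1 := euler_fderiv isOpen_natDomain (hf.contDiffOn v.proj)
    (fun z hz => hh.fderiv_eq hf hz) hz (0, (natDeriv v.proj v η).1)
  rw [fderiv_fderiv_symm isOpen_natDomain (hf.contDiffOn v.proj) hz] at h1
  rw [map_sub, map_smul, sub_apply, smul_apply, smul_eq_mul]
  simp only at h1
  linear_combination (-(2 * localFun P v.proj (natChart v.proj v))) * h1

/-- A semispray acts on 0-homogeneous functions in a projectively invariant way. -/
lemma IsProjectiveDeformation.act_eq (hP : IsProjectiveDeformation G G' P)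
    (hh : Homogeneous 0 f) (h0 : v ∈ slit n M) :
    act G' f v = act G f v := by
  have h1 := hh v h0
  rw [act, zero_mul] at h1
  rw [act, hP.eq v h0, map_sub, map_smul, h1, smul_zero, sub_zero, act]

/-- Geodesic sprays map 0-homogeneous functions to 1-homogeneous functions. -/
lemma IsGeodesicSpray.homogeneous_act (hF : IsFinsler F) (hG : IsGeodesicSpray F G)
    (hf : SmoothFun f) (hh : Homogeneous 0 f) : Homogeneous 1 (act G f) := by
  refine homogeneous_of_fderiv_eq (hf.act hG.smooth) fun x₀ z hz => ?_
  have h1 : localFun (act G f) x₀ =ᶠ[nhds z]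
      fun w => fderiv ℝ (localFun f x₀) w (localField G x₀ w) := by
    filter_upwards [isOpen_natDomain.mem_nhds hz] with w hw using hf.localFun_act hw
  rw [h1.fderiv_eq, (hG.isLocalSpray hF x₀).fderiv_field_vert (hf.contDiffOn x₀)
    (fun z hz => by rw [hh.fderiv_eq hf hz, zero_mul]) hz, hf.localFun_act hz, one_mul]

lemma fderiv_localFun_distortion (hF : IsFinsler F) {σ : Coord n → ℝ}
    (hσ : ∀ v ∈ slit n M, v.proj ∈ (chartAt (Coord n) x₀).source →
      volCoeff Ω x₀ v = σ (chartAt (Coord n) x₀ v.proj)) (hz : z ∈ natDomain x₀) :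
    fderiv ℝ (localFun (distortion F Ω) x₀) z =
      fderiv ℝ (localDistortion (localFun (energy F) x₀) σ) z := by
  apply Filter.EventuallyEq.fderiv_eq
  filter_upwards [isOpen_natDomain.mem_nhds hz] with w hw using hF.localFun_distortion hσ hw

/-- The distortion of a geodesically sprayed Finsler metric is 0-homogeneous. -/
lemma IsFinsler.homogeneous_distortion (hF : IsFinsler F) (hG : IsGeodesicSpray F G)
    (hΩ : IsVolumeForm Ω) : Homogeneous 0 (distortion F Ω) := by
  refine homogeneous_of_fderiv_eq (hF.smooth_distortion hΩ) fun x₀ z hz => ?_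
  obtain ⟨σ, hσs, hσp, hσ⟩ := hΩ x₀
  rw [fderiv_localFun_distortion hF hσ hz, zero_mul]
  exact (hG.isLocalSpray hF x₀).fderiv_localDistortion_vert (fun z hz => hF.det_ne_zero hz)
    (chartAt (Coord n) x₀).open_target (fun z hz => hz.1) hσs hσp hz

/-- The right side involves only the spray and the density, so comparing two metrics reduces to
comparing the divergences of their sprays. -/
lemma sFunction_eq (hF : IsFinsler F) (hG : IsGeodesicSpray F G) (hΩ : IsVolumeForm Ω)
    {σ : Coord n → ℝ} (hσs : ContDiffOn ℝ ∞ σ (chartAt (Coord n) x₀).target)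
    (hσp : ∀ x ∈ (chartAt (Coord n) x₀).target, 0 < σ x)
    (hσ : ∀ v ∈ slit n M, v.proj ∈ (chartAt (Coord n) x₀).source →
      volCoeff Ω x₀ v = σ (chartAt (Coord n) x₀ v.proj))
    (hv : v ∈ natSource x₀) (h0 : v ∈ slit n M) :
    sFunction F G Ω v = -(1 / 2 : ℝ) * ((vertJacobian (localField G x₀) (natChart x₀ v)).trace
      + fderiv ℝ (fun x => Real.log (σ x)) (natChart x₀ v).1 (natChart x₀ v).2) := by
  have hz := natChart_mem_natDomain hv h0
  rw [sFunction, (hF.smooth_distortion hΩ).act_eq hv h0, fderiv_localFun_distortion hF hσ hz]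
  exact (hG.isLocalSpray hF x₀).fderiv_localDistortion_field (fun z hz => hF.det_ne_zero hz)
    (chartAt (Coord n) x₀).open_target (fun z hz => hz.1) hσs hσp hz

lemma sFunction_projective (hF : IsFinsler F) (hF' : IsFinsler F') (hG : IsGeodesicSpray F G)
    (hG' : IsGeodesicSpray F' G') (hP : IsProjectiveDeformation G G' P) (hΩ : IsVolumeForm Ω)
    (h0 : v ∈ slit n M) :
    sFunction F' G' Ω v = sFunction F G Ω v + ((n : ℝ) + 1) * P v := by
  have hv := mem_natSource_proj v
  have hz := natChart_mem_natDomain hv h0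
  -- One density serves both metrics, so its contribution cancels in the difference of the
  -- `S`-functions.
  obtain ⟨σ, hσs, hσp, hσ⟩ := hΩ v.proj
  have hhom : fderiv ℝ (localFun P v.proj) (natChart v.proj v) (0, (natChart v.proj v).2) =
      localFun P v.proj (natChart v.proj v) := by
    rw [hP.homogeneous.fderiv_eq hP.smooth hz, one_mul]
  have h1 := trace_vertJacobian_projective isOpen_natDomain hz
    (differentiableAt_of_contDiffOn isOpen_natDomain (hG.smooth.contDiffOn v.proj) hz)
    (hP.smooth.differentiableAt hz) hhom fun w hw => hP.localField_eq hw
  rw [localFun_natChart P hv] at h1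
  rw [sFunction_eq hF' hG' hΩ hσs hσp hσ hv h0, sFunction_eq hF hG hΩ hσs hσp hσ hv h0, h1]
  ring

/-- The projective factor is the derivative along the spray of a multiple of the difference of the
distortions. -/
lemma exists_primitive_projectiveFactor (hF : IsFinsler F) (hF' : IsFinsler F')
    (hG : IsGeodesicSpray F G) (hG' : IsGeodesicSpray F' G')
    (hP : IsProjectiveDeformation G G' P) (hΩ : IsVolumeForm Ω) :
    ∃ f₀ : TangentBundle (𝓡 n) M → ℝ,
      SmoothFun f₀ ∧ Homogeneous 0 f₀ ∧ ∀ v ∈ slit n M, P v = act G f₀ v := by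
  have hτ := hF.smooth_distortion hΩ
  have hτ' := hF'.smooth_distortion hΩ
  have hh := hF.homogeneous_distortion hG hΩ
  have hh' := hF'.homogeneous_distortion hG' hΩ
  have hn : (n : ℝ) + 1 ≠ 0 := by positivity
  let f₀ : TangentBundle (𝓡 n) M → ℝ :=
    fun v => ((n : ℝ) + 1)⁻¹ * (distortion F' Ω v - distortion F Ω v)
  have hs : SmoothFun f₀ := SmoothFun.of_contDiffOn fun x₀ =>
    contDiffOn_const.mul ((hτ'.contDiffOn x₀).sub (hτ.contDiffOn x₀))
  have hdiff : ∀ v ∈ slit n M, ∀ ξ : TangentSpace (𝓡 n).tangent v,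
      diff f₀ v ξ = ((n : ℝ) + 1)⁻¹ * (diff (distortion F' Ω) v ξ - diff (distortion F Ω) v ξ) := by
    intro v h0 ξ
    have hv := mem_natSource_proj v
    have hz := natChart_mem_natDomain hv h0
    have h1 : fderiv ℝ (localFun f₀ v.proj) (natChart v.proj v) = ((n : ℝ) + 1)⁻¹ •
        (fderiv ℝ (localFun (distortion F' Ω) v.proj) (natChart v.proj v)
          - fderiv ℝ (localFun (distortion F Ω) v.proj) (natChart v.proj v)) :=
      (((hτ'.differentiableAt hz).hasFDerivAt.sub
        (hτ.differentiableAt hz).hasFDerivAt).const_mul _).fderiv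
    rw [hs.diff_eq hv h0, hτ.diff_eq hv h0, hτ'.diff_eq hv h0, h1]
    rfl
  refine ⟨f₀, hs, fun v h0 => ?_, fun v h0 => ?_⟩
  · have h1 := hh v h0
    have h2 := hh' v h0
    rw [act, zero_mul] at h1 h2
    rw [act, hdiff v h0, h1, h2, sub_zero, mul_zero, zero_mul]
  · have h1 := sFunction_projective hF hF' hG hG' hP hΩ h0
    -- The distortion of `F'` is 0-homogeneous, so `G'` acts on it as `G` does, and the difference
    -- of the `S`-functions is `G` applied to the difference of the distortions.
    rw [sFunction, sFunction, hP.act_eq hh' h0] at h1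
    rw [act, hdiff v h0]
    simp only [act] at h1
    rw [h1]
    field_simp
    ring

/-- The `S`-function of `F'` is 1-homogeneous, so `δ_{G'}` may be replaced by `δ_G` before the
formula for `S` is inserted. -/
lemma chiCurvature_projective (hF : IsFinsler F) (hF' : IsFinsler F') (hG : IsGeodesicSpray F G)
    (hG' : IsGeodesicSpray F' G') (hP : IsProjectiveDeformation G G' P) (hΩ : IsVolumeForm Ω)
    (h0 : v ∈ slit n M) :
    chiCurvature F' G' Ω v
      = chiCurvature F G Ω v + (((n : ℝ) + 1) / 2) • eulerLagrange G P v := by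
  have hS : SmoothFun (sFunction F G Ω) := (hF.smooth_distortion hΩ).act hG.smooth
  have hS' : SmoothFun (sFunction F' G' Ω) := (hF'.smooth_distortion hΩ).act hG'.smooth
  have hhom : Homogeneous 1 (sFunction F' G' Ω) :=
    hG'.homogeneous_act hF' (hF'.smooth_distortion hΩ) (hF'.homogeneous_distortion hG' hΩ)
  have hsemi := hG.isSemispray hF
  rw [chiCurvature, chiCurvature, hP.eulerLagrange_eq hsemi hS' hhom h0,
    eulerLagrange_of_eq_add hS' hS hP.smooth hsemi
      (fun v h0 => sFunction_projective hF hF' hG hG' hP hΩ h0) h0, smul_add, smul_smul]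
  congr 2
  ring

end Projective

end FinslerSpray

end

open FinslerSpray in
theorem theorem5p1 {n : ℕ} {M : Type*} [TopologicalSpace M] [ChartedSpace (Coord n) M]
    [IsManifold (𝓡 n) ∞ M] [T2Space M] [SecondCountableTopology M] [ConnectedSpace M]
    (F F' : TangentBundle (𝓡 n) M → ℝ) (hF : IsFinsler F) (hF' : IsFinsler F')
    (G G' : ∀ v : TangentBundle (𝓡 n) M, TangentSpace (𝓡 n).tangent v)
    (hG : IsGeodesicSpray F G) (hG' : IsGeodesicSpray F' G')
    (P : TangentBundle (𝓡 n) M → ℝ) (hP : IsProjectiveDeformation G G' P)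
    (Ω : ∀ v : TangentBundle (𝓡 n) M, (TangentSpace (𝓡 n).tangent v) [⋀^Fin n ⊕ Fin n]→ₗ[ℝ] ℝ)
    (hΩ : IsVolumeForm Ω) :
    (∀ v ∈ slit n M, sFunction F' G' Ω v = sFunction F G Ω v + ((n : ℝ) + 1) * P v) ∧
    (∀ v ∈ slit n M, chiCurvature F' G' Ω v
      = chiCurvature F G Ω v + (((n : ℝ) + 1) / 2) • eulerLagrange G P v) ∧
    ((∀ v ∈ slit n M, chiCurvature F' G' Ω v = chiCurvature F G Ω v) ↔ IsStrongHamel G P) := by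
  have hchi := fun v (h0 : v ∈ slit n M) => chiCurvature_projective hF hF' hG hG' hP hΩ h0
  have hn : ((n : ℝ) + 1) / 2 ≠ 0 := by positivity
  refine ⟨fun v h0 => sFunction_projective hF hF' hG hG' hP hΩ h0, hchi, fun h => ?_,
    fun h v h0 => ?_⟩
  -- The primitive exists without the equality of the `χ`-curvatures; that equality is needed only
  -- for `δ_G P = 0`.
  · refine ⟨⟨hP.smooth, hP.homogeneous, fun v h0 => ?_⟩,
      exists_primitive_projectiveFactor hF hF' hG hG' hP hΩ⟩
    have h1 := h v h0
    rw [hchi v h0, add_eq_left] at h1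
    exact (smul_eq_zero.1 h1).resolve_left hn
  · rw [hchi v h0, h.hamel.eulerLagrange_eq v h0, smul_zero, add_zero]
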